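/- All manifolds are smooth, finite-dimensional, Hausdorff, second countable and without boundary. Definitions. A $\mathfrak{Q}$-structure $\mathcal{Q}=(N,g_N,\mathcal{I},\theta)$ consists of a connected pseudo-Riemannian manifold $(N,g_N)$, a connected Lie group $\mathcal{I}$ acting smoothly, transitively and effectively on $(N,g_N)$ by isometries, and a smooth $\mathcal{I}$-invariant $1$-form $\theta$ on $N$. For $t\in\mathbb{R}$ let $\mathcal{M}_{t,\mathcal{Q}}=(\mathbb{R}\times N,g_{t,\mathcal{Q}})$, where $g_{t,\mathcal{Q}}=e^{tx}(dx^2+dx\circ\theta+g_N)$ and $dx\circ\theta=dx\otimes\theta+\theta\otimes dx$. Write $g_N(\theta,\theta)$ for the square of the length of $\theta$ in the dual metric. Let $\mathcal{M}=(M,g)$ be a pseudo-Riemannian manifold. A homothety of $\mathcal{M}$ is a diffeomorphism $T$ of $M$ with $T^*g=r^2g$ for some constant $r>0$; $\mathcal{M}$ is homothety homogeneous if its homotheties act transitively. If $\mathcal{H}$ is a connected Lie group acting smoothly, effectively and transitively on $M$ by homotheties, its homothety character is the smooth homomorphism $\lambda:\mathcal{H}\to\mathbb{R}^+$ with $\Phi^*g=\lambda(\Phi)^2g$.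 The sequence $1\to\ker\lambda\to\mathcal{H}\to\mathbb{R}^+\to1$ splits if there is an isomorphism of Lie groups $\mathcal{H}\cong\mathbb{R}^+\times\ker\lambda$ under which $\lambda$ is the projection on the first factor; a splitting yields the central $1$-parameter subgroup $\Phi_s\leftrightarrow(e^s,1)$ of $\mathcal{H}$ and its generating homothety vector field $\xi(p)=\frac{d}{ds}\big|_{s=0}\Phi_s p$ on $M$. $\mathcal{M}$ is VSI if all Weyl scalar invariants (the linear combinations of complete contractions of non-empty products of covariant derivatives $\nabla^kR$, $k\ge0$, of the curvature tensor) vanish identically. Theorem. (1) Let $\mathcal{Q}=(N,g_N,\mathcal{I},\theta)$ be a $\mathfrak{Q}$-structure and let $t\in\mathbb{R}$. Then $g_{t,\mathcal{Q}}$ is non-degenerate if and only if $g_N(\theta,\theta)\ne1$ (at every point of $N$). If $g_N(\theta,\theta)\neq1$, then $\mathcal{M}_{t,\mathcal{Q}}$ is a homothety homogeneous pseudo-Riemannian manifold and, if moreover $t\ne0$, there is a connected Lie group acting smoothly, effectively and transitively on it by homotheties whose homothety character $\lambda$ is non-trivial and for which the sequence defined by $\lambda$ splits. (2) Let $\mathcal{M}=(M,g)$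 be a connected Riemannian manifold which is not VSI, and let $\mathcal{H}$ be a connected Lie group acting smoothly, effectively and transitively on $M$ by homotheties, with non-trivial homothety character $\lambda$. Suppose that the sequence defined by $\lambda$ splits and that the vector field $\xi$ of a splitting is spacelike ($g(\xi,\xi)>0$ at every point). Then there are a $\mathfrak{Q}$-structure $\mathcal{Q}=(N,g_N,\mathcal{I},\theta)$ and a real number $t\ne0$ such that $g_N(\theta,\theta)\neq1$ (at every point of $N$) and $\mathcal{M}$ is isometric to $\mathcal{M}_{t,\mathcal{Q}}$. -/

import Mathlib

open scoped Manifold ContDiff Bundle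
open Bundle

universe u

noncomputable section

/-! ### Fields of bilinear forms, pseudo-Riemannian metrics, homotheties -/

section Metrics

variable {E : Type*} [NormedAddCommGroup E] [NormedSpace ℝ E]
  {X : Type*} [TopologicalSpace X] (J : ModelWithCorners ℝ E X)
  (M : Type*) [TopologicalSpace M] [ChartedSpace X M]

/-- A (not necessarily smooth or symmetric) field of bilinear forms on the tangent spaces of `M`. -/
abbrev BilinField : Type _ := ∀ x : M, TangentSpace J x →L[ℝ] TangentSpace J x →L[ℝ] ℝ

/-- A (not necessarily smooth) field of covectors on `M`. -/
abbrev CovectorField : Type _ := ∀ x : M, TangentSpace J x →L[ℝ] ℝ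

variable {J M}

/-- All the bilinear forms of the field are non-degenerate. -/
def BilinField.Nondegenerate (g : BilinField J M) : Prop :=
  ∀ (x : M) (v : TangentSpace J x), (∀ w : TangentSpace J x, g x v w = 0) → v = 0

/-- `g` is a smooth pseudo-Riemannian metric (of arbitrary signature). -/
structure BilinField.IsPseudoRiemannian [IsManifold J ∞ M] (g : BilinField J M) : Prop where
  smooth : ContMDiff J (J.prod 𝓘(ℝ, E →L[ℝ] E →L[ℝ] ℝ)) ∞
    (fun x ↦ TotalSpace.mk' (E →L[ℝ] E →L[ℝ] ℝ)
      (E := fun x : M ↦ TangentSpace J x →L[ℝ] TangentSpace J x →L[ℝ] ℝ) x (g x))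
  symm : ∀ (x : M) (v w : TangentSpace J x), g x v w = g x w v
  nondegenerate : g.Nondegenerate

/-- `g` is a smooth Riemannian metric. -/
structure BilinField.IsRiemannian [IsManifold J ∞ M] (g : BilinField J M) : Prop
    extends g.IsPseudoRiemannian where
  pos : ∀ (x : M) (v : TangentSpace J x), v ≠ 0 → 0 < g x v v

/-- `θ` is a smooth `1`-form. -/
def CovectorField.IsSmooth [IsManifold J ∞ M] (θ : CovectorField J M) : Prop :=
  ContMDiff J (J.prod 𝓘(ℝ, E →L[ℝ] ℝ)) ∞
    (fun x ↦ TotalSpace.mk' (E →L[ℝ] ℝ) (E := fun x : M ↦ TangentSpace J x →L[ℝ] ℝ) x (θ x))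

/-- The squared length `g(θ, θ)` of the covector `θ x` for the metric dual to `g x`: it is
`θ (θ♯)`, where `θ♯` is the preimage of `θ` under the isomorphism `v ↦ g(v, ·)`. -/
def BilinField.dualNormSq (g : BilinField J M) (θ : CovectorField J M) (x : M) : ℝ :=
  θ x ((g x).inverse (θ x))

/-- `T^* g' = c • g`. -/
def IsHomothetyWith {E' : Type*} [NormedAddCommGroup E'] [NormedSpace ℝ E']
    {X' : Type*} [TopologicalSpace X'] {J' : ModelWithCorners ℝ E' X'}
    {M' : Type*} [TopologicalSpace M'] [ChartedSpace X' M']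
    (g : BilinField J M) (g' : BilinField J' M') (T : M → M') (c : ℝ) : Prop :=
  ∀ (x : M) (v w : TangentSpace J x),
    g' (T x) (mfderiv J J' T x v) (mfderiv J J' T x w) = c * g x v w

/-- The homotheties of `(M, g)`, i.e. the diffeomorphisms `T` of `M` with `T^* g = r² g` for some
`r > 0`, act transitively on `M`. -/
def IsHomothetyHomogeneous (g : BilinField J M) : Prop :=
  ∀ x y : M, ∃ T : Diffeomorph J J M M ∞, (∃ r : ℝ, 0 < r ∧ IsHomothetyWith g g T (r ^ 2)) ∧ T x = y

/-- Two manifolds with metrics are isometric. -/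
def AreIsometric {E' : Type*} [NormedAddCommGroup E'] [NormedSpace ℝ E']
    {X' : Type*} [TopologicalSpace X'] {J' : ModelWithCorners ℝ E' X'}
    {M' : Type*} [TopologicalSpace M'] [ChartedSpace X' M']
    (g : BilinField J M) (g' : BilinField J' M') : Prop :=
  ∃ T : Diffeomorph J J' M M' ∞, IsHomothetyWith g g' T 1

end Metrics

/-! ### Curvature, its covariant derivatives and Weyl scalar invariants -/

section Curvature

variable {E : Type*} [NormedAddCommGroup E] [NormedSpace ℝ E]

/-- For a metric `G` on (an open subset of) the vector space `E`: the Levi-Civita derivative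
`∇_u v` of the constant vector field `v` in the direction `u`, given by the Koszul formula
`2 G(∇_u v, w) = u G(v, w) + v G(u, w) - w G(u, v)`. -/
def christoffel (G : E → E →L[ℝ] E →L[ℝ] ℝ) (y u v : E) : E :=
  (G y).inverse ((1 / 2 : ℝ) •
    (fderiv ℝ G y u v + fderiv ℝ G y v u - ((fderiv ℝ G y).flip u).flip v))

/-- The curvature operator `R(u, v) w = ∇_u ∇_v w - ∇_v ∇_u w` on constant vector fields. -/
def curvatureOp (G : E → E →L[ℝ] E →L[ℝ] ℝ) (y u v w : E) : E :=
  fderiv ℝ (fun z ↦ christoffel G z v w) y u + christoffel G y u (christoffel G y v w)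
    - (fderiv ℝ (fun z ↦ christoffel G z u w) y v + christoffel G y v (christoffel G y u w))

/-- The covariant derivative of a covariant tensor field of rank `r`; the new last slot is the
direction of differentiation. -/
def covDeriv (G : E → E →L[ℝ] E →L[ℝ] ℝ) {r : ℕ} (T : E → (Fin r → E) → ℝ) :
    E → (Fin (r + 1) → E) → ℝ :=
  fun y v ↦ fderiv ℝ (fun z ↦ T z (Fin.init v)) y (v (Fin.last r))
    - ∑ a : Fin r, T y (Function.update (Fin.init v) a
        (christoffel G y (v (Fin.last r)) (v a.castSucc)))

/-- The `k`-th covariant derivative `∇^k R` of the curvature tensor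
`R(x₁, x₂, x₃, x₄) = G(R(x₁, x₂) x₃, x₄)`. -/
def nablaCurvature (G : E → E →L[ℝ] E →L[ℝ] ℝ) : (k : ℕ) → E → (Fin (4 + k) → E) → ℝ
  | 0 => fun y v ↦ G y (curvatureOp G y (v 0) (v 1) (v 2)) (v 3)
  | k + 1 => covDeriv G (nablaCurvature G k)

variable [FiniteDimensional ℝ E]

/-- A complete contraction of the tensor `∇^{k 0} R ⊗ ⋯ ⊗ ∇^{k (s-1)} R`. The bijection `σ` sorts
the index slots of the tensor into `r` pairs `{(a, false), (a, true)}`, and the two slots of each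
pair are contracted by means of the inverse metric
`g^{ij} = (b.coord i) (G⁻¹ (b.coord j))` in a basis `b` of `E`. -/
def weylContraction (G : E → E →L[ℝ] E →L[ℝ] ℝ) {s r : ℕ} (k : Fin s → ℕ)
    (σ : (Σ j : Fin s, Fin (4 + k j)) ≃ Fin r × Bool) (y : E) : ℝ :=
  let b := Module.finBasis ℝ E
  let coord (i : Fin (Module.finrank ℝ E)) : E →L[ℝ] ℝ := LinearMap.toContinuousLinearMap (b.coord i)
  ∑ c : Fin r × Bool → Fin (Module.finrank ℝ E),
    (∏ a : Fin r, coord (c (a, false)) ((G y).inverse (coord (c (a, true))))) *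
      ∏ j : Fin s, nablaCurvature G (k j) y (fun i ↦ b (c (σ ⟨j, i⟩)))

variable {M : Type*} [TopologicalSpace M] [ChartedSpace E M]

/-- The expression of `g` in the preferred chart at `p`. -/
def BilinField.inChart (g : BilinField 𝓘(ℝ, E) M) (p : M) (y : E) : E →L[ℝ] E →L[ℝ] ℝ :=
  let ψ : E → M := (extChartAt 𝓘(ℝ, E) p).symm
  let B : E →L[ℝ] E →L[ℝ] ℝ := g (ψ y)
  let D : E →L[ℝ] E := mfderiv 𝓘(ℝ, E) 𝓘(ℝ, E) ψ y
  B.bilinearComp D D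

/-- `(M, g)` is VSI: all Weyl scalar invariants vanish identically. As the Weyl scalar invariants
are the linear combinations of complete contractions of (non-empty) products of covariant
derivatives of the curvature tensor, it is enough to ask this of the complete contractions. -/
def BilinField.IsVSI (g : BilinField 𝓘(ℝ, E) M) : Prop :=
  ∀ (s r : ℕ) (_ : 0 < s) (k : Fin s → ℕ) (σ : (Σ j : Fin s, Fin (4 + k j)) ≃ Fin r × Bool) (p : M),
    weylContraction (g.inChart p) k σ (extChartAt 𝓘(ℝ, E) p p) = 0

end Curvature

/-! ### Transitive groups of homotheties -/

/-- The multiplicative group `ℝ⁺` (with Mathlib's group structure on positive elements). -/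
abbrev PosReal : Type := {x : ℝ // 0 < x}

/-- The smooth structure of `ℝ⁺` as an open subset of `ℝ`. -/
instance : ChartedSpace ℝ PosReal :=
  inferInstanceAs (ChartedSpace ℝ (⟨Set.Ioi (0 : ℝ), isOpen_Ioi⟩ : TopologicalSpace.Opens ℝ))

section HomothetyGroups

variable {E : Type*} [NormedAddCommGroup E] [NormedSpace ℝ E]
  {X : Type*} [TopologicalSpace X] {J : ModelWithCorners ℝ E X}
  {M : Type u} [TopologicalSpace M] [ChartedSpace X M]

/-- A connected Lie group `H` of homotheties of `(M, g)` (i.e. a connected Lie group acting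
smoothly and effectively on `M` by homotheties) which acts transitively on `M`, together with its
homothety character `h ↦ λ(h)`, determined by `h^* g = λ(h)² g`. -/
structure HomothetyGroup (g : BilinField J M) where
  F : Type
  [normedAddCommGroup : NormedAddCommGroup F]
  [normedSpace : NormedSpace ℝ F]
  [finiteDimensional : FiniteDimensional ℝ F]
  H : Type u
  [group : Group H]
  [topologicalSpace : TopologicalSpace H]
  [chartedSpace : ChartedSpace F H]
  [lieGroup : LieGroup 𝓘(ℝ, F) ∞ H]
  [connectedSpace : ConnectedSpace H]
  [mulAction : MulAction H M]
  [contMDiffSMul : ContMDiffSMul 𝓘(ℝ, F) J ∞ H M]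
  [isPretransitive : MulAction.IsPretransitive H M]
  [faithfulSMul : FaithfulSMul H M]
  char : H →* PosReal
  contMDiff_char : ContMDiff 𝓘(ℝ, F) 𝓘(ℝ, ℝ) ∞ char
  homothety : ∀ h : H, IsHomothetyWith g g (fun x ↦ h • x) ((char h : ℝ) ^ 2)

attribute [instance] HomothetyGroup.normedAddCommGroup HomothetyGroup.normedSpace
  HomothetyGroup.finiteDimensional HomothetyGroup.group HomothetyGroup.topologicalSpace
  HomothetyGroup.chartedSpace HomothetyGroup.lieGroup HomothetyGroup.connectedSpace
  HomothetyGroup.mulAction HomothetyGroup.contMDiffSMul HomothetyGroup.isPretransitive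
  HomothetyGroup.faithfulSMul

/-- A splitting of `1 → ker λ → H → ℝ⁺ → 1`: an isomorphism of Lie groups
`H ≅ ℝ⁺ × ker λ` under which `λ` becomes the projection on the first factor. Here `ker λ` is a
Lie group for the topology induced by `H` (its smooth structure is unique). -/
structure HomothetyGroup.Splitting {g : BilinField J M} (𝓗 : HomothetyGroup g) where
  K : Type
  [normedAddCommGroup : NormedAddCommGroup K]
  [normedSpace : NormedSpace ℝ K]
  [finiteDimensional : FiniteDimensional ℝ K]
  [chartedSpace : ChartedSpace K 𝓗.char.ker]
  [lieGroup : LieGroup 𝓘(ℝ, K) ∞ 𝓗.char.ker]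
  iso : 𝓗.H ≃* PosReal × 𝓗.char.ker
  contMDiff_iso : ContMDiff 𝓘(ℝ, 𝓗.F) (𝓘(ℝ, ℝ).prod 𝓘(ℝ, K)) ∞ iso
  contMDiff_iso_symm : ContMDiff (𝓘(ℝ, ℝ).prod 𝓘(ℝ, K)) 𝓘(ℝ, 𝓗.F) ∞ iso.symm
  fst_iso : ∀ h : 𝓗.H, (iso h).1 = 𝓗.char h

/-- The `1`-parameter subgroup `s ↦ Φ_s` of `H` with `λ(Φ_s) = e^s` defined by a splitting; it is
central in `H`. -/
def HomothetyGroup.Splitting.flow {g : BilinField J M} {𝓗 : HomothetyGroup g}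
    (S : 𝓗.Splitting) (s : ℝ) : 𝓗.H :=
  S.iso.symm (⟨Real.exp s, Real.exp_pos s⟩, 1)

/-- The homothety vector field `ξ` on `M` generating the central `1`-parameter group of a
splitting, `ξ(x) = d/ds (Φ_s x)` at `s = 0`. -/
def HomothetyGroup.Splitting.generator {g : BilinField J M} {𝓗 : HomothetyGroup g}
    (S : 𝓗.Splitting) (x : M) : TangentSpace J x :=
  (mfderiv 𝓘(ℝ, ℝ) J (fun s : ℝ ↦ S.flow s • x) 0 : ℝ →L[ℝ] E) 1

/-- The generator `ξ` is spacelike everywhere. -/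
def HomothetyGroup.Splitting.IsSpacelike {g : BilinField J M} {𝓗 : HomothetyGroup g}
    (S : 𝓗.Splitting) : Prop :=
  ∀ x : M, 0 < g x (S.generator x) (S.generator x)

end HomothetyGroups

/-! ### `𝔔`-structures -/

/-- The symmetric bilinear form `c (dx² + dx ∘ α + B)` on `ℝ × V`, where
`dx ∘ α = dx ⊗ α + α ⊗ dx`; see `productForm_apply`. -/
def productForm {V : Type*} [NormedAddCommGroup V] [NormedSpace ℝ V] (c : ℝ)
    (α : V →L[ℝ] ℝ) (B : V →L[ℝ] V →L[ℝ] ℝ) : ℝ × V →L[ℝ] ℝ × V →L[ℝ] ℝ :=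
  let dx : ℝ × V →L[ℝ] ℝ := ContinuousLinearMap.fst ℝ ℝ V
  let pr : ℝ × V →L[ℝ] V := ContinuousLinearMap.snd ℝ ℝ V
  c • (dx.smulRight dx + (dx.smulRight (α.comp pr) + (α.comp pr).smulRight dx)
    + B.bilinearComp pr pr)

theorem productForm_apply {V : Type*} [NormedAddCommGroup V] [NormedSpace ℝ V] (c : ℝ)
    (α : V →L[ℝ] ℝ) (B : V →L[ℝ] V →L[ℝ] ℝ) (a b : ℝ) (v w : V) :
    productForm c α B (a, v) (b, w) = c * (a * b + (a * α w + b * α v) + B v w) := by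
  change c * (a * b + (a * α w + α v * b) + B v w) = _
  rw [mul_comm b]

/-- A `𝔔`-structure `(N, g, G, θ)`: a connected Lie group `G` acting smoothly, transitively and
effectively by isometries on a connected pseudo-Riemannian manifold `(N, g)`, and a smooth
`G`-invariant `1`-form `θ` on `N`. -/
structure QStructure where
  E : Type
  [normedAddCommGroupE : NormedAddCommGroup E]
  [normedSpaceE : NormedSpace ℝ E]
  [finiteDimensionalE : FiniteDimensional ℝ E]
  N : Type u
  [topologicalSpaceN : TopologicalSpace N]
  [chartedSpaceN : ChartedSpace E N]
  [isManifoldN : IsManifold 𝓘(ℝ, E) ∞ N]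
  [t2SpaceN : T2Space N]
  [secondCountableTopologyN : SecondCountableTopology N]
  [connectedSpaceN : ConnectedSpace N]
  g : BilinField 𝓘(ℝ, E) N
  isPseudoRiemannian : g.IsPseudoRiemannian
  F : Type
  [normedAddCommGroupF : NormedAddCommGroup F]
  [normedSpaceF : NormedSpace ℝ F]
  [finiteDimensionalF : FiniteDimensional ℝ F]
  G : Type u
  [groupG : Group G]
  [topologicalSpaceG : TopologicalSpace G]
  [chartedSpaceG : ChartedSpace F G]
  [lieGroupG : LieGroup 𝓘(ℝ, F) ∞ G]
  [connectedSpaceG : ConnectedSpace G]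
  [mulAction : MulAction G N]
  [contMDiffSMul : ContMDiffSMul 𝓘(ℝ, F) 𝓘(ℝ, E) ∞ G N]
  [isPretransitive : MulAction.IsPretransitive G N]
  [faithfulSMul : FaithfulSMul G N]
  isometry : ∀ a : G, IsHomothetyWith g g (fun x ↦ a • x) 1
  θ : CovectorField 𝓘(ℝ, E) N
  smooth_θ : θ.IsSmooth
  invariant_θ : ∀ (a : G) (x : N) (v : TangentSpace 𝓘(ℝ, E) x),
    θ (a • x) (mfderiv 𝓘(ℝ, E) 𝓘(ℝ, E) (fun y ↦ a • y) x v) = θ x v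

namespace QStructure

attribute [instance] normedAddCommGroupE normedSpaceE finiteDimensionalE topologicalSpaceN
  chartedSpaceN isManifoldN t2SpaceN secondCountableTopologyN connectedSpaceN
  normedAddCommGroupF normedSpaceF finiteDimensionalF groupG topologicalSpaceG chartedSpaceG
  lieGroupG connectedSpaceG mulAction contMDiffSMul isPretransitive faithfulSMul

/-- The symmetric bilinear form field `e^{tx} (dx² + dx ∘ θ + g)` on `ℝ × N`. -/
def metric (Q : QStructure.{u}) (t : ℝ) : BilinField (𝓘(ℝ, ℝ).prod 𝓘(ℝ, Q.E)) (ℝ × Q.N) :=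
  fun p ↦ productForm (V := Q.E) (Real.exp (t * p.1)) (Q.θ p.2) (Q.g p.2)

end QStructure

end

/-! Part (1) is linear algebra plus an explicit group. A vector `(a, v)` in the radical of `dx² + dx
∘ θ + g_N` satisfies `a + θ(v) = 0` and `g_N(v, ·) = -a θ`, so `v = -a θ♯` and `a (1 - g_N(θ, θ)) =
0`; a nonzero solution exists exactly when `g_N(θ, θ) = 1` (`productForm_nondegenerate_iff`). The
map `(x, y) ↦ (x + s, a • y)` preserves `dx`, `θ` and `g_N` and multiplies `e^{tx}` by `e^{ts}`
(`isHomothetyWith_translate`). These maps act transitively, and for `t ≠ 0` the substitution `s =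
(2/t) log r` turns them into an action of `ℝ⁺ × G` whose character is the first projection, so the
sequence splits.

For part (2), centrality of the flow `Φ_s` makes `ξ` invariant under the whole group, so `f = g(ξ,
ξ)` obeys `f(h x) = λ(h)² f(x)` (`lengthSq_smul`). Hence `f` grows like `e^{2s}` along the flow, `N
= {f = 1}` is a regular hypersurface, and every flow line meets it exactly once. The kernel of `λ`
preserves `N` and acts transitively on it. With `g_N` the restriction of `g` and `θ = g(ξ, ·)`
restricted to `N`, the diffeomorphism `(s, n) ↦ Φ_s n` pulls `g` back to `e^{2s} (ds² + ds ∘ θ +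
g_N)`, so `t = 2` (`IsSpacelike.exists_qStructure`). Positivity of `g` makes `g_N` non-degenerate,
and `g_N(θ, θ) ≠ 1` follows from the criterion of part (1). -/

noncomputable section

/-! ### Smoothness of tensor fields tested on local vector fields -/

section SmoothFields

variable {E : Type*} [NormedAddCommGroup E] [NormedSpace ℝ E]
  {X : Type*} [TopologicalSpace X] {J : ModelWithCorners ℝ E X}
  {M : Type*} [TopologicalSpace M] [ChartedSpace X M]
  {E' : Type*} [NormedAddCommGroup E'] [NormedSpace ℝ E']
  {X' : Type*} [TopologicalSpace X'] {J' : ModelWithCorners ℝ E' X'}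
  {M' : Type*} [TopologicalSpace M'] [ChartedSpace X' M']

theorem contMDiffAt_of_trivial {b : M' → M} {f : M' → ℝ} {x : M'}
    (h : ContMDiffAt J' (J.prod 𝓘(ℝ, ℝ)) ∞
      (fun m ↦ TotalSpace.mk' ℝ (E := Bundle.Trivial M ℝ) (b m) (f m)) x) :
    ContMDiffAt J' 𝓘(ℝ, ℝ) ∞ f x :=
  (contMDiffAt_totalSpace.1 h).2

/-- A map into the continuous linear maps from a finite-dimensional space is smooth if its
evaluations are. -/
theorem contMDiffAt_clm_of_apply [FiniteDimensional ℝ E] {F : Type*} [NormedAddCommGroup F]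
    [NormedSpace ℝ F] {A : M' → E →L[ℝ] F} {x : M'}
    (h : ∀ v, ContMDiffAt J' 𝓘(ℝ, F) ∞ (fun y ↦ A y v) x) :
    ContMDiffAt J' 𝓘(ℝ, E →L[ℝ] F) ∞ A x := by
  let b := Module.finBasis ℝ E
  let R (i : Fin (Module.finrank ℝ E)) : F →L[ℝ] E →L[ℝ] F :=
    ContinuousLinearMap.smulRightL ℝ E F (LinearMap.toContinuousLinearMap (b.coord i))
  -- Expansion in the dual basis: `A y = ∑ bᵢ* ⊗ A y (bᵢ)`, where each `R i` is a fixed continuous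
  -- linear map.
  have key : A = fun y ↦ ∑ i, R i (A y (b i)) := by
    funext y
    ext v
    conv_lhs => rw [← b.sum_repr v]
    simp only [map_sum, map_smul, sum_apply, R,
      ContinuousLinearMap.smulRightL_apply_apply]
    rfl
  rw [key]
  refine contMDiffAt_finsetSum fun i _ ↦ ?_
  exact (R i).contDiff.contMDiff.contMDiffAt.comp x (h (b i))

variable [IsManifold J ∞ M]

/-- The constant local vector fields of a trivialization of the tangent bundle are smooth. -/
theorem contMDiffAt_trivializationAt_symm (x₀ : M) (v : E) :
    ContMDiffAt J J.tangent ∞ (fun x ↦ (⟨x,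
      (trivializationAt E (TangentSpace J : M → Type _) x₀).symm x v⟩ : TangentBundle J M)) x₀ := by
  let e := trivializationAt E (TangentSpace J : M → Type _) x₀
  have hx₀ : x₀ ∈ e.baseSet := mem_baseSet_trivializationAt E _ x₀
  have ht : (x₀, v) ∈ e.target := e.mem_target.2 hx₀
  have h1 := (e.contMDiffOn_symm (IB := J) (n := ∞) _ ht).contMDiffAt (e.open_target.mem_nhds ht)
  have h2 : ContMDiffAt J (J.prod 𝓘(ℝ, E)) ∞ (fun x : M ↦ (x, v)) x₀ :=
    contMDiffAt_id.prodMk contMDiffAt_const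
  refine (h1.comp x₀ h2).congr_of_eventuallyEq ?_
  filter_upwards [e.open_baseSet.mem_nhds hx₀] with x hx
  exact e.mk_symm hx v

/-- A covector field is smooth if its values on smooth local vector fields are. -/
theorem CovectorField.isSmooth_of_apply [FiniteDimensional ℝ E] {θ : CovectorField J M}
    (h : ∀ (x₀ : M) (v : ∀ x : M, TangentSpace J x),
      ContMDiffAt J J.tangent ∞ (fun x ↦ (⟨x, v x⟩ : TangentBundle J M)) x₀ →
      ContMDiffAt J 𝓘(ℝ, ℝ) ∞ (fun x ↦ θ x (v x)) x₀) : θ.IsSmooth := by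
  intro x₀
  rw [contMDiffAt_hom_bundle]
  refine ⟨contMDiffAt_id, contMDiffAt_clm_of_apply fun v ↦ ?_⟩
  refine (h x₀ _ (contMDiffAt_trivializationAt_symm x₀ v)).congr_of_eventuallyEq ?_
  have hx₀ := mem_baseSet_trivializationAt E (TangentSpace J : M → Type _) x₀
  filter_upwards [(trivializationAt E (TangentSpace J : M → Type _) x₀).open_baseSet.mem_nhds hx₀]
    with x hx
  simp only [ContinuousLinearMap.inCoordinates, ContinuousLinearMap.comp_apply,
    Trivialization.symmL_apply _ hx]
  simp

/-- A field of bilinear forms is smooth if its values on smooth local vector fields are. -/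
theorem BilinField.contMDiff_of_apply [FiniteDimensional ℝ E] {g : BilinField J M}
    (h : ∀ (x₀ : M) (v w : ∀ x : M, TangentSpace J x),
      ContMDiffAt J J.tangent ∞ (fun x ↦ (⟨x, v x⟩ : TangentBundle J M)) x₀ →
      ContMDiffAt J J.tangent ∞ (fun x ↦ (⟨x, w x⟩ : TangentBundle J M)) x₀ →
      ContMDiffAt J 𝓘(ℝ, ℝ) ∞ (fun x ↦ g x (v x) (w x)) x₀) :
    ContMDiff J (J.prod 𝓘(ℝ, E →L[ℝ] E →L[ℝ] ℝ)) ∞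
    (fun x ↦ TotalSpace.mk' (E →L[ℝ] E →L[ℝ] ℝ)
      (E := fun x : M ↦ TangentSpace J x →L[ℝ] TangentSpace J x →L[ℝ] ℝ) x (g x)) := by
  intro x₀
  rw [contMDiffAt_hom_bundle]
  refine ⟨contMDiffAt_id,
    contMDiffAt_clm_of_apply fun v ↦ contMDiffAt_clm_of_apply fun w ↦ ?_⟩
  refine (h x₀ _ _ (contMDiffAt_trivializationAt_symm x₀ v)
    (contMDiffAt_trivializationAt_symm x₀ w)).congr_of_eventuallyEq ?_
  have hx₀ := mem_baseSet_trivializationAt E (TangentSpace J : M → Type _) x₀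
  filter_upwards [(trivializationAt E (TangentSpace J : M → Type _) x₀).open_baseSet.mem_nhds hx₀]
    with x hx
  refine (inCoordinates_apply_eq₂ (ϕ := g x) (v := v) (w := w) (F₃ := ℝ)
    (E₃ := Bundle.Trivial M ℝ) hx hx (Set.mem_univ x)).trans ?_
  simp

theorem CovectorField.IsSmooth.contMDiffAt_apply {θ : CovectorField J M} (hθ : θ.IsSmooth)
    {b : M' → M} {v : ∀ m, TangentSpace J (b m)} {x : M'}
    (hv : ContMDiffAt J' J.tangent ∞ (fun m ↦ (⟨b m, v m⟩ : TangentBundle J M)) x) :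
    ContMDiffAt J' 𝓘(ℝ, ℝ) ∞ (fun m ↦ θ (b m) (v m)) x := by
  have hb : ContMDiffAt J' J ∞ b x := (contMDiffAt_totalSpace.1 hv).1
  exact contMDiffAt_of_trivial (J := J) (b := b)
    (ContMDiffAt.clm_bundle_apply (E₂ := Bundle.Trivial M ℝ) ((hθ (b x)).comp x hb) hv)

theorem BilinField.contMDiffAt_apply {g : BilinField J M}
    (hg : ContMDiff J (J.prod 𝓘(ℝ, E →L[ℝ] E →L[ℝ] ℝ)) ∞
      (fun x ↦ TotalSpace.mk' (E →L[ℝ] E →L[ℝ] ℝ)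
        (E := fun x : M ↦ TangentSpace J x →L[ℝ] TangentSpace J x →L[ℝ] ℝ) x (g x)))
    {b : M' → M} {v w : ∀ m, TangentSpace J (b m)} {x : M'}
    (hv : ContMDiffAt J' J.tangent ∞ (fun m ↦ (⟨b m, v m⟩ : TangentBundle J M)) x)
    (hw : ContMDiffAt J' J.tangent ∞ (fun m ↦ (⟨b m, w m⟩ : TangentBundle J M)) x) :
    ContMDiffAt J' 𝓘(ℝ, ℝ) ∞ (fun m ↦ g (b m) (v m) (w m)) x := by
  have hb : ContMDiffAt J' J ∞ b x := (contMDiffAt_totalSpace.1 hv).1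
  exact contMDiffAt_of_trivial (J := J) (b := b)
    (ContMDiffAt.clm_bundle_apply₂ (E₃ := Bundle.Trivial M ℝ) ((hg (b x)).comp x hb) hv hw)

/-- The image of a smooth vector field along a map under the derivative of a smooth map. -/
theorem ContMDiff.contMDiffAt_mfderiv_apply [IsManifold J' ∞ M'] {f : M' → M}
    (hf : ContMDiff J' J ∞ f) {P : Type*} [TopologicalSpace P] {E'' : Type*}
    [NormedAddCommGroup E''] [NormedSpace ℝ E''] {X'' : Type*} [TopologicalSpace X'']
    {J'' : ModelWithCorners ℝ E'' X''} [ChartedSpace X'' P]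
    {b : P → M'} {v : ∀ m, TangentSpace J' (b m)} {x : P}
    (hv : ContMDiffAt J'' J'.tangent ∞ (fun m ↦ (⟨b m, v m⟩ : TangentBundle J' M')) x) :
    ContMDiffAt J'' J.tangent ∞
      (fun m ↦ (⟨f (b m), mfderiv J' J f (b m) (v m)⟩ : TangentBundle J M)) x :=
  ((hf.contMDiff_tangentMap (m := ∞) (by simp)).contMDiffAt).comp x hv

end SmoothFields

/-! ### Transport of a smooth structure along a homeomorphism -/

section Transport

variable {V : Type*} [NormedAddCommGroup V] [NormedSpace ℝ V]
  {A B : Type*} [TopologicalSpace A] [TopologicalSpace B] [ChartedSpace V B]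

/-- The charted space structure on `A` for which the homeomorphism `e : A ≃ₜ B` identifies the
charts. -/
abbrev Homeomorph.pullbackChartedSpace (e : A ≃ₜ B) : ChartedSpace V A where
  atlas := Set.image (fun c ↦ e.toOpenPartialHomeomorph.trans c) (atlas V B)
  chartAt x := e.toOpenPartialHomeomorph.trans (chartAt V (e x))
  mem_chart_source x := by simp
  chart_mem_atlas x := ⟨_, chart_mem_atlas V (e x), rfl⟩

variable (e : A ≃ₜ B) [IsManifold 𝓘(ℝ, V) ∞ B]

/-- In a transition map between transported charts the factors `e.symm` and `e` cancel, leaving a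
transition map of `B`. -/
theorem Homeomorph.isManifold_pullback :
    letI := e.pullbackChartedSpace (V := V)
    IsManifold 𝓘(ℝ, V) ∞ A := by
  let := e.pullbackChartedSpace (V := V)
  have : HasGroupoid A (contDiffGroupoid ∞ 𝓘(ℝ, V)) := by
    refine ⟨?_⟩
    rintro _ _ ⟨c, hc, rfl⟩ ⟨c', hc', rfl⟩
    refine StructureGroupoid.mem_of_eqOnSource _
      (HasGroupoid.compatible (G := contDiffGroupoid ∞ 𝓘(ℝ, V)) hc hc') ⟨?_, ?_⟩
    · ext x; simp
    · intro x _; simp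
  exact { this with }

theorem Homeomorph.contMDiff_pullback :
    letI := e.pullbackChartedSpace (V := V)
    ContMDiff 𝓘(ℝ, V) 𝓘(ℝ, V) ∞ e := by
  let := e.pullbackChartedSpace (V := V)
  have := e.isManifold_pullback (V := V)
  intro x
  have h1 := contMDiffAt_of_mem_maximalAtlas (I := 𝓘(ℝ, V)) (n := ∞)
    (IsManifold.chart_mem_maximalAtlas (M := A) x) (mem_chart_source V x)
  have h2 := contMDiffAt_symm_of_mem_maximalAtlas (I := 𝓘(ℝ, V)) (n := ∞)
    (IsManifold.chart_mem_maximalAtlas (M := B) (e x)) (mem_chart_target V (e x))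
  refine (h2.comp x h1).congr_of_eventuallyEq ?_
  filter_upwards [(chartAt V x).open_source.mem_nhds (mem_chart_source V x)] with y hy
  exact ((chartAt V (e x)).left_inv hy.2).symm

theorem Homeomorph.contMDiff_symm_pullback :
    letI := e.pullbackChartedSpace (V := V)
    ContMDiff 𝓘(ℝ, V) 𝓘(ℝ, V) ∞ e.symm := by
  let := e.pullbackChartedSpace (V := V)
  have := e.isManifold_pullback (V := V)
  intro x
  have h1 := contMDiffAt_of_mem_maximalAtlas (I := 𝓘(ℝ, V)) (n := ∞)
    (IsManifold.chart_mem_maximalAtlas (M := B) x) (mem_chart_source V x)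
  have h2 := contMDiffAt_symm_of_mem_maximalAtlas (I := 𝓘(ℝ, V)) (n := ∞)
    (IsManifold.chart_mem_maximalAtlas (M := A) (e.symm x)) (mem_chart_target V (e.symm x))
  -- The left chart lives on `A`, the right one on `B`; by definition the former is the chart of `B`
  -- at `e (e.symm x)`.
  have h3 : chartAt V (e.symm x) (e.symm x) = chartAt V x x := by
    change chartAt V (e (e.symm x)) (e (e.symm x)) = _
    rw [e.apply_symm_apply]
  rw [h3] at h2
  refine (h2.comp x h1).congr_of_eventuallyEq ?_
  filter_upwards [(chartAt V x).open_source.mem_nhds (mem_chart_source V x)] with y hy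
  change _ = e.symm ((chartAt V (e (e.symm x))).symm (chartAt V x y))
  rw [e.apply_symm_apply, (chartAt V x).left_inv hy]

end Transport

/-! ### The Lie group of positive reals -/

theorem contMDiff_posReal_iff {E : Type*} [NormedAddCommGroup E] [NormedSpace ℝ E]
    {X : Type*} [TopologicalSpace X] {J : ModelWithCorners ℝ E X}
    {M : Type*} [TopologicalSpace M] [ChartedSpace X M] {f : M → PosReal} :
    ContMDiff J 𝓘(ℝ, ℝ) ∞ f ↔ ContMDiff J 𝓘(ℝ, ℝ) ∞ (fun x ↦ (f x : ℝ)) :=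
  (ContMDiff.subtypeVal_comp_iff (⟨Set.Ioi (0 : ℝ), isOpen_Ioi⟩ : TopologicalSpace.Opens ℝ) f).symm

theorem contMDiff_posReal_val : ContMDiff 𝓘(ℝ, ℝ) 𝓘(ℝ, ℝ) ∞ (fun x : PosReal ↦ (x : ℝ)) :=
  contMDiff_posReal_iff.1 contMDiff_id

instance : LieGroup 𝓘(ℝ, ℝ) ∞ PosReal :=
  { (inferInstanceAs (IsManifold 𝓘(ℝ, ℝ) ∞
      (⟨Set.Ioi (0 : ℝ), isOpen_Ioi⟩ : TopologicalSpace.Opens ℝ)) : IsManifold 𝓘(ℝ, ℝ) ∞ PosReal) with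
    contMDiff_mul := contMDiff_posReal_iff.2
      ((contMDiff_posReal_val.comp contMDiff_fst).mul (contMDiff_posReal_val.comp contMDiff_snd))
    contMDiff_inv := contMDiff_posReal_iff.2 fun x ↦
      (contMDiff_posReal_val x).inv₀ x.2.ne' }

theorem contMDiff_log_posReal :
    ContMDiff 𝓘(ℝ, ℝ) 𝓘(ℝ, ℝ) ∞ (fun x : PosReal ↦ Real.log x) := fun x ↦
  (contMDiffAt_iff_contDiffAt.2 (Real.contDiffAt_log.2 x.2.ne')).comp x (contMDiff_posReal_val x)

theorem contMDiff_exp_posReal :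
    ContMDiff 𝓘(ℝ, ℝ) 𝓘(ℝ, ℝ) ∞ (fun s : ℝ ↦ (⟨Real.exp s, Real.exp_pos s⟩ : PosReal)) :=
  contMDiff_posReal_iff.2 Real.contDiff_exp.contMDiff

/-! ### The product form -/

section ProductForm

variable {V : Type*} [NormedAddCommGroup V] [NormedSpace ℝ V] [FiniteDimensional ℝ V]

/-- `ContinuousLinearMap.inverse` has the default value zero off the invertible maps. Equality of
the dimensions of `V` and its dual makes a non-degenerate form invertible, so that `B.inverse α` is
really `α♯`. -/
theorem exists_equiv_of_nondegenerate {B : V →L[ℝ] V →L[ℝ] ℝ}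
    (hB : ∀ v, (∀ w, B v w = 0) → v = 0) : ∃ e : V ≃L[ℝ] (V →L[ℝ] ℝ), (e : V →L[ℝ] V →L[ℝ] ℝ) = B := by
  have hinj : Function.Injective (B : V →ₗ[ℝ] V →L[ℝ] ℝ) := by
    rw [← LinearMap.ker_eq_bot, LinearMap.ker_eq_bot']
    exact fun v hv ↦ hB v fun w ↦ congrArg (fun L : V →L[ℝ] ℝ ↦ L w) hv
  have hdim : Module.finrank ℝ V = Module.finrank ℝ (V →L[ℝ] ℝ) := by
    rw [← (LinearMap.toContinuousLinearMap (𝕜 := ℝ) (E := V) (F' := ℝ)).finrank_eq]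
    exact Subspace.dual_finrank_eq.symm
  refine ⟨(LinearEquiv.ofInjectiveOfFinrankEq _ hinj hdim).toContinuousLinearEquiv, ?_⟩
  ext x w
  rfl

/-- If `α(α♯) = 1`, then `(1, -α♯)` lies in the radical. Conversely, pairing a radical vector `(a,
v)` with `(1, 0)` and with `(0, w)` gives `a + α v = 0` and `v = -a α♯`, hence `a (1 - α(α♯)) = 0`.
-/
theorem productForm_nondegenerate_iff {c : ℝ} (hc : c ≠ 0) (α : V →L[ℝ] ℝ) {B : V →L[ℝ] V →L[ℝ] ℝ}
    (hB : ∀ v, (∀ w, B v w = 0) → v = 0) :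
    (∀ p, (∀ q, productForm c α B p q = 0) → p = 0) ↔ α (B.inverse α) ≠ 1 := by
  obtain ⟨e, rfl⟩ := exists_equiv_of_nondegenerate hB
  rw [ContinuousLinearMap.inverse_equiv]
  change _ ↔ α (e.symm α) ≠ 1
  have hu (w : V) : e (e.symm α) w = α w := by rw [e.apply_symm_apply]
  constructor
  · intro h h1
    have := h (1, -e.symm α) fun q ↦ by
      obtain ⟨b, w⟩ := q
      rw [productForm_apply]
      simp [h1]
    exact one_ne_zero (congrArg Prod.fst this)
  · rintro h ⟨a, v⟩ hp
    have h1 : a + α v = 0 := by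
      have := hp (1, 0)
      rw [productForm_apply] at this
      simpa [hc] using this
    have h2 : e v = -a • α := by
      ext w
      have := hp (0, w)
      rw [productForm_apply] at this
      have h3 : a * α w + e v w = 0 := by simpa [hc] using this
      simp only [smul_apply, smul_eq_mul]
      linarith
    have h3 : v = -a • e.symm α := by rw [← map_smul, ← h2, e.symm_apply_apply]
    have h4 : a * (1 - α (e.symm α)) = 0 := by
      rw [h3, map_smul, smul_eq_mul] at h1
      linarith
    have ha : a = 0 := (mul_eq_zero.1 h4).resolve_right (sub_ne_zero.2 h.symm)
    rw [h3, ha]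
    simp

end ProductForm

theorem contMDiffAt_fiber_of_real {E : Type*} [NormedAddCommGroup E] [NormedSpace ℝ E]
    {X : Type*} [TopologicalSpace X] {J : ModelWithCorners ℝ E X}
    {M : Type*} [TopologicalSpace M] [ChartedSpace X M] {b : M → ℝ} {v : M → ℝ} {x : M}
    (h : ContMDiffAt J 𝓘(ℝ, ℝ).tangent ∞
      (fun m ↦ (⟨b m, v m⟩ : TangentBundle 𝓘(ℝ, ℝ) ℝ)) x) :
    ContMDiffAt J 𝓘(ℝ, ℝ) ∞ v x := by
  simpa using (contMDiffAt_totalSpace.1 h).2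

/-! ### Metrics of `𝔔`-structures -/

namespace QStructure

variable (Q : QStructure.{u}) (t : ℝ)

theorem nondegenerate_metric_iff :
    (Q.metric t).Nondegenerate ↔ ∀ y : Q.N, Q.g.dualNormSq Q.θ y ≠ 1 := by
  have key (p : ℝ × Q.N) := productForm_nondegenerate_iff (V := Q.E)
    (Real.exp_pos (t * p.1)).ne' (Q.θ p.2) (Q.isPseudoRiemannian.nondegenerate p.2)
  exact ⟨fun h y ↦ (key (0, y)).1 (h (0, y)), fun h p ↦ (key p).2 (h p.2)⟩

theorem metric_apply (p : ℝ × Q.N) (v w : TangentSpace (𝓘(ℝ, ℝ).prod 𝓘(ℝ, Q.E)) p) :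
    Q.metric t p v w = Real.exp (t * p.1) *
      (v.1 * w.1 + (v.1 * Q.θ p.2 w.2 + w.1 * Q.θ p.2 v.2) + Q.g p.2 v.2 w.2) :=
  productForm_apply (V := Q.E) ..

theorem isPseudoRiemannian_metric (h : ∀ y : Q.N, Q.g.dualNormSq Q.θ y ≠ 1) :
    (Q.metric t).IsPseudoRiemannian where
  nondegenerate := (Q.nondegenerate_metric_iff t).2 h
  symm := by
    intro p v w
    rw [Q.metric_apply, Q.metric_apply, Q.isPseudoRiemannian.symm p.2 v.2 w.2]
    ring
  smooth := by
    refine BilinField.contMDiff_of_apply fun p v w hv hw ↦ ?_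
    -- The components of a smooth field on the product are its images under the derivatives of the
    -- two projections, hence smooth.
    have h1 {v : ∀ x : ℝ × Q.N, TangentSpace (𝓘(ℝ, ℝ).prod 𝓘(ℝ, Q.E)) x}
        (hv : ContMDiffAt (𝓘(ℝ, ℝ).prod 𝓘(ℝ, Q.E)) (𝓘(ℝ, ℝ).prod 𝓘(ℝ, Q.E)).tangent ∞
          (fun x ↦ (⟨x, v x⟩ : TangentBundle (𝓘(ℝ, ℝ).prod 𝓘(ℝ, Q.E)) (ℝ × Q.N))) p) :
        ContMDiffAt (𝓘(ℝ, ℝ).prod 𝓘(ℝ, Q.E)) 𝓘(ℝ, ℝ) ∞ (fun x ↦ (v x).1) p := by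
      have := contMDiff_fst.contMDiffAt_mfderiv_apply hv
      simp only [mfderiv_fst] at this
      exact contMDiffAt_fiber_of_real this
    have h2 {v : ∀ x : ℝ × Q.N, TangentSpace (𝓘(ℝ, ℝ).prod 𝓘(ℝ, Q.E)) x}
        (hv : ContMDiffAt (𝓘(ℝ, ℝ).prod 𝓘(ℝ, Q.E)) (𝓘(ℝ, ℝ).prod 𝓘(ℝ, Q.E)).tangent ∞
          (fun x ↦ (⟨x, v x⟩ : TangentBundle (𝓘(ℝ, ℝ).prod 𝓘(ℝ, Q.E)) (ℝ × Q.N))) p) :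
        ContMDiffAt (𝓘(ℝ, ℝ).prod 𝓘(ℝ, Q.E)) 𝓘(ℝ, Q.E).tangent ∞
          (fun x ↦ (⟨x.2, (v x).2⟩ : TangentBundle 𝓘(ℝ, Q.E) Q.N)) p := by
      have := contMDiff_snd.contMDiffAt_mfderiv_apply hv
      simp only [mfderiv_snd] at this
      exact this
    have he : ContMDiffAt (𝓘(ℝ, ℝ).prod 𝓘(ℝ, Q.E)) 𝓘(ℝ, ℝ) ∞
        (fun x : ℝ × Q.N ↦ Real.exp (t * x.1)) p :=
      (ContDiff.contMDiff (f := fun s : ℝ ↦ Real.exp (t * s)) (by fun_prop)).contMDiffAt.comp p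
        contMDiffAt_fst
    simp only [Q.metric_apply]
    exact he.mul ((((h1 hv).mul (h1 hw)).add (((h1 hv).mul
      (Q.smooth_θ.contMDiffAt_apply (h2 hw))).add ((h1 hw).mul
      (Q.smooth_θ.contMDiffAt_apply (h2 hv))))).add
      (BilinField.contMDiffAt_apply Q.isPseudoRiemannian.smooth (h2 hv) (h2 hw)))

theorem contMDiff_const_smul (a : Q.G) :
    ContMDiff 𝓘(ℝ, Q.E) 𝓘(ℝ, Q.E) ∞ (fun y : Q.N ↦ a • y) :=
  (contMDiff_smul (I := 𝓘(ℝ, Q.F)) (I' := 𝓘(ℝ, Q.E)) (G := Q.G) (M := Q.N)).comp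
    (contMDiff_const.prodMk contMDiff_id)

/-- The translation leaves `dx` unchanged, `a` preserves `θ` and `g_N`, and only the conformal
factor changes, by `e^{t(x+s)} = e^{ts} e^{tx}`. -/
theorem isHomothetyWith_translate (s : ℝ) (a : Q.G) :
    IsHomothetyWith (Q.metric t) (Q.metric t) (fun p ↦ (p.1 + s, a • p.2))
      (Real.exp (t * s)) := by
  intro p v w
  have h1 : HasMFDerivAt 𝓘(ℝ, ℝ) 𝓘(ℝ, ℝ) (fun x : ℝ ↦ x + s) p.1
      (ContinuousLinearMap.id ℝ ℝ) :=
    ((hasFDerivAt_id p.1).add_const s).hasMFDerivAt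
  have h2 := ((Q.contMDiff_const_smul a).mdifferentiable (by simp) p.2).hasMFDerivAt
  have h3 (v : TangentSpace (𝓘(ℝ, ℝ).prod 𝓘(ℝ, Q.E)) p) :
      mfderiv (𝓘(ℝ, ℝ).prod 𝓘(ℝ, Q.E)) (𝓘(ℝ, ℝ).prod 𝓘(ℝ, Q.E))
        (fun p : ℝ × Q.N ↦ (p.1 + s, a • p.2)) p v =
        (v.1, mfderiv 𝓘(ℝ, Q.E) 𝓘(ℝ, Q.E) (fun y ↦ a • y) p.2 v.2) := by
    have := (h1.prodMap h2).mfderiv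
    rw [h1.mfderiv] at this
    exact congrArg (fun L : ℝ × Q.E →L[ℝ] ℝ × Q.E ↦ L v) this
  rw [h3, h3]
  refine (Q.metric_apply t (p.1 + s, a • p.2) _ _).trans ?_
  rw [Q.metric_apply]
  simp only [Q.invariant_θ a p.2 v.2, Q.invariant_θ a p.2 w.2, Q.isometry a p.2 v.2 w.2,
    mul_add t, Real.exp_add]
  ring

/-- The homothety `(x, y) ↦ (x + s, a • y)` as a diffeomorphism. -/
def translate (s : ℝ) (a : Q.G) : Diffeomorph (𝓘(ℝ, ℝ).prod 𝓘(ℝ, Q.E))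
    (𝓘(ℝ, ℝ).prod 𝓘(ℝ, Q.E)) (ℝ × Q.N) (ℝ × Q.N) ∞ where
  toFun p := (p.1 + s, a • p.2)
  invFun p := (p.1 - s, a⁻¹ • p.2)
  left_inv p := by simp
  right_inv p := by simp
  contMDiff_toFun := (contMDiff_fst.add contMDiff_const).prodMk
    ((Q.contMDiff_const_smul a).comp contMDiff_snd)
  contMDiff_invFun := (contMDiff_fst.sub contMDiff_const).prodMk
    ((Q.contMDiff_const_smul a⁻¹).comp contMDiff_snd)

theorem isHomothetyHomogeneous_metric : IsHomothetyHomogeneous (Q.metric t) := by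
  intro x y
  obtain ⟨a, ha⟩ := MulAction.exists_smul_eq Q.G x.2 y.2
  -- The ratio is the square root of the factor `e^{ts}` for the shift `s = y.1 - x.1`.
  refine ⟨Q.translate (y.1 - x.1) a, ⟨Real.exp (t * (y.1 - x.1) / 2), Real.exp_pos _, ?_⟩,
    Prod.ext (add_sub_cancel _ _) ha⟩
  rw [← Real.exp_nat_mul, show ((2 : ℕ) : ℝ) * (t * (y.1 - x.1) / 2) = t * (y.1 - x.1) by
    push_cast; ring]
  exact Q.isHomothetyWith_translate t (y.1 - x.1) a

/-- The action of `ℝ⁺ × G` on `ℝ × N` by homotheties, in which `r ∈ ℝ⁺` acts with ratio `r`. -/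
abbrev homothetyAction : MulAction (PosReal × Q.G) (ℝ × Q.N) where
  -- The shift is chosen so that `e^{t s} = r²`. For `t = 0` the quotient is zero by convention, and
  -- the formula still defines an action.
  smul h p := (p.1 + 2 / t * Real.log h.1, h.2 • p.2)
  one_smul p := by
    change (p.1 + 2 / t * Real.log ((1 : PosReal) : ℝ), (1 : Q.G) • p.2) = p
    simp
  mul_smul h k p := by
    change (p.1 + 2 / t * Real.log ((h.1 * k.1 : PosReal) : ℝ), (h.2 * k.2) • p.2) =
      ((p.1 + 2 / t * Real.log k.1) + 2 / t * Real.log h.1, h.2 • k.2 • p.2)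
    rw [Positive.val_mul, Real.log_mul h.1.2.ne' k.1.2.ne', mul_smul]
    congr 1
    ring

instance : ConnectedSpace PosReal :=
  Subtype.connectedSpace isConnected_Ioi

/-- `HomothetyGroup` asks for a group modelled on a normed space with its standard model, so the
product model is identified with the standard model on `ℝ × Q.F`. -/
instance : ChartedSpace (ℝ × Q.F) (PosReal × Q.G) :=
  inferInstanceAs (ChartedSpace (ModelProd ℝ Q.F) (PosReal × Q.G))

instance : LieGroup 𝓘(ℝ, ℝ × Q.F) ∞ (PosReal × Q.G) := by
  rw [modelWithCornersSelf_prod]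
  exact inferInstanceAs (LieGroup (𝓘(ℝ, ℝ).prod 𝓘(ℝ, Q.F)) ∞ (PosReal × Q.G))

theorem contMDiffSMul_homothetyAction :
    letI := Q.homothetyAction t
    ContMDiffSMul 𝓘(ℝ, ℝ × Q.F) (𝓘(ℝ, ℝ).prod 𝓘(ℝ, Q.E)) ∞ (PosReal × Q.G) (ℝ × Q.N) := by
  let := Q.homothetyAction t
  refine ⟨?_⟩
  rw [modelWithCornersSelf_prod]
  exact ((contMDiff_fst.comp contMDiff_snd).add (contMDiff_const.mul
    (contMDiff_log_posReal.comp (contMDiff_fst.comp contMDiff_fst)))).prodMk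
    ((contMDiff_smul (I := 𝓘(ℝ, Q.F)) (I' := 𝓘(ℝ, Q.E)) (G := Q.G) (M := Q.N)).comp
      ((contMDiff_snd.comp contMDiff_fst).prodMk (contMDiff_snd.comp contMDiff_snd)))

/-- The group `ℝ⁺ × G` of homotheties of `ℝ × N`. -/
abbrev homothetyGroup (ht : t ≠ 0) : HomothetyGroup (Q.metric t) :=
  letI := Q.homothetyAction t
  { F := ℝ × Q.F
    H := PosReal × Q.G
    contMDiffSMul := Q.contMDiffSMul_homothetyAction t
    isPretransitive := by
      refine ⟨fun x y ↦ ?_⟩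
      obtain ⟨a, ha⟩ := MulAction.exists_smul_eq Q.G x.2 y.2
      -- The first component solves `(2/t) log r = y.1 - x.1`.
      refine ⟨(⟨Real.exp (t / 2 * (y.1 - x.1)), Real.exp_pos _⟩, a), Prod.ext ?_ ha⟩
      change x.1 + 2 / t * Real.log (Real.exp (t / 2 * (y.1 - x.1))) = y.1
      rw [Real.log_exp]
      field_simp
      ring
    faithfulSMul := by
      refine ⟨fun {h k} hhk ↦ ?_⟩
      have h1 (p : ℝ × Q.N) : p.1 + 2 / t * Real.log h.1 = p.1 + 2 / t * Real.log k.1 :=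
        congrArg Prod.fst (hhk p)
      have h2 (p : ℝ × Q.N) : h.2 • p.2 = k.2 • p.2 := congrArg Prod.snd (hhk p)
      obtain ⟨y⟩ := (inferInstance : Nonempty Q.N)
      refine Prod.ext (Subtype.ext ?_) (FaithfulSMul.eq_of_smul_eq_smul fun y ↦ h2 (0, y))
      have h3 := add_left_cancel (h1 (0, y))
      exact Real.log_injOn_pos h.1.2 k.1.2 (mul_left_cancel₀ (div_ne_zero two_ne_zero ht) h3)
    char := MonoidHom.fst PosReal Q.G
    contMDiff_char := by
      rw [modelWithCornersSelf_prod]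
      exact contMDiff_fst
    homothety := fun h ↦ by
      have := Q.isHomothetyWith_translate t (2 / t * Real.log h.1) h.2
      have h2 : Real.exp (t * (2 / t * Real.log h.1)) = (h.1 : ℝ) ^ 2 := by
        rw [← mul_assoc, mul_div_cancel₀ _ ht, ← Nat.cast_ofNat, Real.exp_nat_mul,
          Real.exp_log h.1.2]
      rw [h2] at this
      exact this }

theorem homothetyGroup_char_ne_one (ht : t ≠ 0) : (Q.homothetyGroup t ht).char ≠ 1 := by
  intro h
  have h1 : (⟨2, two_pos⟩ : PosReal) = 1 :=
    congrArg (fun f : PosReal × Q.G →* PosReal ↦ f (⟨2, two_pos⟩, 1)) h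
  exact absurd (congrArg Subtype.val h1) (by norm_num)

/-- The kernel of the homothety character of `ℝ⁺ × G` is `G`. -/
def kerEquiv : (MonoidHom.fst PosReal Q.G).ker ≃ₜ* Q.G where
  toFun k := k.1.2
  invFun a := ⟨(1, a), rfl⟩
  left_inv k := Subtype.ext (Prod.ext k.2.symm rfl)
  right_inv a := rfl
  map_mul' _ _ := rfl
  continuous_toFun := by fun_prop
  continuous_invFun := by fun_prop

/-- The kernel `1 × G` receives the smooth structure of `G` through `kerEquiv`; the splitting is
then the identity on `ℝ⁺` times this identification. -/
theorem nonempty_splitting (ht : t ≠ 0) : Nonempty (Q.homothetyGroup t ht).Splitting := by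
  let e := Q.kerEquiv.toHomeomorph
  let cs : ChartedSpace Q.F (MonoidHom.fst PosReal Q.G).ker := e.pullbackChartedSpace
  have hm := e.isManifold_pullback (V := Q.F)
  have he := e.contMDiff_pullback (V := Q.F)
  have hes := e.contMDiff_symm_pullback (V := Q.F)
  have hL : LieGroup 𝓘(ℝ, Q.F) ∞ (MonoidHom.fst PosReal Q.G).ker :=
    { hm with
      contMDiff_mul := (hes.comp ((he.comp contMDiff_fst).mul (he.comp contMDiff_snd))).congr
        fun p ↦ (Q.kerEquiv.symm_apply_apply (p.1 * p.2)).symm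
      contMDiff_inv := (hes.comp he.inv).congr fun p ↦ (Q.kerEquiv.symm_apply_apply p⁻¹).symm }
  have h1 : ContMDiff 𝓘(ℝ, ℝ × Q.F) (𝓘(ℝ, ℝ).prod 𝓘(ℝ, Q.F)) ∞
      (fun p : PosReal × Q.G ↦ (p.1, Q.kerEquiv.symm p.2)) := by
    rw [modelWithCornersSelf_prod]
    exact contMDiff_fst.prodMk (hes.comp contMDiff_snd)
  have h2 : ContMDiff (𝓘(ℝ, ℝ).prod 𝓘(ℝ, Q.F)) 𝓘(ℝ, ℝ × Q.F) ∞
      (fun p : PosReal × (MonoidHom.fst PosReal Q.G).ker ↦ (p.1, Q.kerEquiv p.2)) := by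
    rw [modelWithCornersSelf_prod]
    exact contMDiff_fst.prodMk (he.comp contMDiff_snd)
  exact ⟨
    { K := Q.F
      chartedSpace := cs
      lieGroup := hL
      iso := (MulEquiv.refl PosReal).prodCongr Q.kerEquiv.symm.toMulEquiv
      contMDiff_iso := h1
      contMDiff_iso_symm := h2
      fst_iso := fun _ ↦ rfl }⟩

end QStructure

/-! ### Regular level sets as manifolds -/

section LevelSet

open Topology Filter

variable {E : Type*} [NormedAddCommGroup E] [NormedSpace ℝ E] [FiniteDimensional ℝ E]
  {V : Type*} [NormedAddCommGroup V] [NormedSpace ℝ V] [FiniteDimensional ℝ V]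

/-- A nonzero linear form is the first component of a linear isomorphism onto a product. -/
theorem exists_continuousLinearEquiv_fst_eq (hV : Module.finrank ℝ V + 1 = Module.finrank ℝ E)
    (L : E →L[ℝ] ℝ) (hL : L ≠ 0) :
    ∃ P : E →L[ℝ] V, ∃ e : E ≃L[ℝ] ℝ × V, (e : E →L[ℝ] ℝ × V) = L.prod P := by
  have hker : Module.finrank ℝ (LinearMap.ker (L : E →ₗ[ℝ] ℝ)) = Module.finrank ℝ V := by
    have h := Module.Dual.finrank_ker_add_one_of_ne_zero (f := (L : E →ₗ[ℝ] ℝ))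
      (fun h ↦ hL (ContinuousLinearMap.coe_injective h))
    omega
  obtain ⟨u, hu⟩ : ∃ u, L u = 1 := by
    obtain ⟨v, hv⟩ := ContinuousLinearMap.exists_ne_zero hL
    exact ⟨(L v)⁻¹ • v, by simp [hv]⟩
  let k := LinearEquiv.ofFinrankEq _ _ hker
  -- The projection `x ↦ x - L(x) u` onto the kernel along `u`; together with `L` it determines `x`.
  let P₀ : E →ₗ[ℝ] LinearMap.ker (L : E →ₗ[ℝ] ℝ) :=
    (LinearMap.id - (L : E →ₗ[ℝ] ℝ).smulRight u).codRestrict _ (fun x ↦ by simp [hu])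
  let P : E →L[ℝ] V := LinearMap.toContinuousLinearMap (k.toLinearMap ∘ₗ P₀)
  have hinj : Function.Injective ((L.prod P : E →L[ℝ] ℝ × V) : E →ₗ[ℝ] ℝ × V) := by
    rw [← LinearMap.ker_eq_bot, LinearMap.ker_eq_bot']
    intro x hx
    have h1 : L x = 0 := congrArg Prod.fst hx
    have h2 : k (P₀ x) = 0 := congrArg Prod.snd hx
    have h3 : P₀ x = 0 := by simpa using h2
    have h4 : x - L x • u = 0 := congrArg Subtype.val h3
    simpa [h1] using h4
  have hdim : Module.finrank ℝ E = Module.finrank ℝ (ℝ × V) := by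
    rw [Module.finrank_prod, Module.finrank_self]; omega
  refine ⟨P, (LinearEquiv.ofInjectiveOfFinrankEq _ hinj hdim).toContinuousLinearEquiv, ?_⟩
  ext x <;> simp <;> rfl

variable {M : Type*} [TopologicalSpace M] [ChartedSpace E M] [IsManifold 𝓘(ℝ, E) ∞ M]

/-- Near a regular point, a smooth function is the first coordinate of a smooth chart. -/
theorem exists_adapted_chart (hV : Module.finrank ℝ V + 1 = Module.finrank ℝ E) {f : M → ℝ}
    (hf : ContMDiff 𝓘(ℝ, E) 𝓘(ℝ, ℝ) ∞ f) (p : M) (hp : mfderiv 𝓘(ℝ, E) 𝓘(ℝ, ℝ) f p ≠ 0) :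
    ∃ c : OpenPartialHomeomorph M (ℝ × V), p ∈ c.source ∧ (∀ x ∈ c.source, (c x).1 = f x) ∧
      ContMDiffOn 𝓘(ℝ, E) 𝓘(ℝ, ℝ × V) ∞ c c.source ∧
      ContMDiffOn 𝓘(ℝ, ℝ × V) 𝓘(ℝ, E) ∞ c.symm c.target := by
  let φ := chartAt E p
  have hφ : φ ∈ IsManifold.maximalAtlas 𝓘(ℝ, E) ∞ M := IsManifold.chart_mem_maximalAtlas p
  let F : E → ℝ := f ∘ φ.symm
  have hF : ∀ x ∈ φ.target, ContDiffAt ℝ ∞ F x := fun x hx ↦ by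
    rw [← contMDiffAt_iff_contDiffAt]
    exact hf.contMDiffAt.comp x (contMDiffAt_symm_of_mem_maximalAtlas hφ hx)
  have hpt : φ p ∈ φ.target := mem_chart_target E p
  have hL : fderiv ℝ F (φ p) ≠ 0 := by
    have : mfderiv 𝓘(ℝ, E) 𝓘(ℝ, ℝ) f p = fderiv ℝ F (φ p) := by
      rw [(hf.mdifferentiable (by simp) p).mfderiv]
      simp only [writtenInExtChartAt, mfld_simps, fderivWithin_univ, chartAt_self_eq]
      rfl
    rwa [this] at hp
  obtain ⟨P, e, he⟩ := exists_continuousLinearEquiv_fst_eq hV _ hL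
  -- `P` completes the differential of `F` at `φ p` to an isomorphism, so the inverse function
  -- theorem applies to `Ψ`.
  let Ψ : E → ℝ × V := fun x ↦ (F x, P x)
  have hΨ : ∀ x ∈ φ.target, ContDiffAt ℝ ∞ Ψ x := fun x hx ↦
    (hF x hx).prodMk P.contDiff.contDiffAt
  have hΨ' : HasFDerivAt Ψ (e : E →L[ℝ] ℝ × V) (φ p) := by
    rw [he]
    exact ((hF _ hpt).differentiableAt (by simp)).hasFDerivAt.prodMk P.hasFDerivAt
  let c₀ := (hΨ _ hpt).toOpenPartialHomeomorph Ψ hΨ' (by simp)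
  -- The inverse has to be smooth on the whole target of the chart, so the source is cut down to the
  -- open set where the derivative of `Ψ` is invertible.
  let W : Set E := φ.target ∩ fderiv ℝ Ψ ⁻¹' Set.range ((↑) : (E ≃L[ℝ] ℝ × V) → E →L[ℝ] ℝ × V)
  have hW : IsOpen W := by
    refine ContinuousOn.isOpen_inter_preimage ?_ φ.open_target ContinuousLinearEquiv.isOpen
    exact ContDiffOn.continuousOn_fderiv_of_isOpen (n := ∞)
      (fun x hx ↦ (hΨ x hx).contDiffWithinAt) φ.open_target (by simp)
  have hpW : φ p ∈ W := ⟨hpt, e, hΨ'.fderiv.symm⟩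
  let c₁ := c₀.restrOpen W hW
  have hc₁s : ∀ x ∈ c₁.source, x ∈ W := fun x hx ↦ hx.2
  have hc₁ : ∀ y ∈ c₁.target, ContDiffAt ℝ ∞ c₁.symm y := fun y hy ↦ by
    obtain ⟨hx, e', he'⟩ := hc₁s _ (c₁.map_target hy)
    refine c₁.contDiffAt_symm hy (f₀' := e') ?_ (hΨ _ hx)
    rw [he']
    exact ((hΨ _ hx).differentiableAt (by simp)).hasFDerivAt
  refine ⟨φ.trans c₁, ?_, ?_, ?_, ?_⟩
  · rw [OpenPartialHomeomorph.trans_source]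
    exact ⟨mem_chart_source E p,
      (hΨ _ hpt).mem_toOpenPartialHomeomorph_source hΨ' (by simp), hpW⟩
  · intro x hx
    rw [OpenPartialHomeomorph.trans_source] at hx
    change f (φ.symm (φ x)) = f x
    rw [φ.left_inv hx.1]
  · intro x hx
    rw [OpenPartialHomeomorph.trans_source] at hx
    refine ContMDiffAt.contMDiffWithinAt ?_
    exact (contMDiffAt_iff_contDiffAt.2 (hΨ _ (hc₁s _ hx.2).1)).comp x
      (contMDiffAt_of_mem_maximalAtlas hφ hx.1)
  · intro y hy
    rw [OpenPartialHomeomorph.trans_target] at hy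
    refine ContMDiffAt.contMDiffWithinAt ?_
    exact (contMDiffAt_symm_of_mem_maximalAtlas hφ hy.2).comp y
      (contMDiffAt_iff_contDiffAt.2 (hc₁ y hy.1))

/-- The chart of a level set of `f` defined by a chart of the ambient space whose first coordinate
is `f`. -/
def sliceChart {M : Type*} [TopologicalSpace M] {V : Type*} [TopologicalSpace V] {f : M → ℝ} {a : ℝ}
    (p : {x // f x = a}) (c : OpenPartialHomeomorph M (ℝ × V))
    (hc : ∀ x ∈ c.source, (c x).1 = f x) : OpenPartialHomeomorph {x // f x = a} V := by
  classical
  have hinv (v : V) (hv : (a, v) ∈ c.target) : f (c.symm (a, v)) = a := by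
    rw [← hc _ (c.map_target hv), c.right_inv hv]
  have hfst (x : {x // f x = a}) (hx : (x : M) ∈ c.source) : (a, (c x).2) = c x :=
    Prod.ext ((hc x hx).trans x.2).symm rfl
  exact
  { toFun := fun x ↦ (c x).2
    -- Off the target the value is irrelevant; `p` only serves as a point of the level set.
    invFun := fun v ↦ if h : (a, v) ∈ c.target then ⟨c.symm (a, v), hinv v h⟩ else p
    source := Subtype.val ⁻¹' c.source
    target := (fun v ↦ (a, v)) ⁻¹' c.target
    map_source' := fun x hx ↦ by
      change (a, (c x).2) ∈ c.target
      rw [hfst x hx]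
      exact c.map_source hx
    map_target' := fun v hv ↦ by
      simp only [Set.mem_preimage] at hv ⊢
      rw [dif_pos hv]
      exact c.map_target hv
    left_inv' := fun x hx ↦ by
      have h : (a, (c x).2) ∈ c.target := by rw [hfst x hx]; exact c.map_source hx
      rw [dif_pos h]
      exact Subtype.ext (by simp only [hfst x hx, c.left_inv hx])
    right_inv' := fun v hv ↦ by
      simp only [Set.mem_preimage] at hv
      rw [dif_pos hv]
      simp only [c.right_inv hv]
    open_source := c.open_source.preimage continuous_subtype_val
    open_target := c.open_target.preimage (by fun_prop)
    continuousOn_toFun := continuous_snd.comp_continuousOn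
      (c.continuousOn.comp continuous_subtype_val.continuousOn fun _ h ↦ h)
    continuousOn_invFun := by
      refine Topology.IsInducing.subtypeVal.continuousOn_iff.2 ?_
      refine (c.continuousOn_symm.comp (f := fun v ↦ (a, v)) (by fun_prop)
        fun _ h ↦ h).congr fun v hv ↦ ?_
      exact congrArg Subtype.val (dif_pos (show (a, v) ∈ c.target from hv)) }

theorem coe_sliceChart_symm {M : Type*} [TopologicalSpace M] {V : Type*} [TopologicalSpace V]
    {f : M → ℝ} {a : ℝ} (p : {x // f x = a}) (c : OpenPartialHomeomorph M (ℝ × V))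
    (hc : ∀ x ∈ c.source, (c x).1 = f x) {v : V} (hv : v ∈ (sliceChart p c hc).target) :
    ((sliceChart p c hc).symm v : M) = c.symm (a, v) := by
  replace hv : (a, v) ∈ c.target := hv
  exact congrArg Subtype.val (dif_pos hv)

/-- A regular level set of a smooth function carries a manifold structure for which the inclusion
is smooth and has local smooth retractions. -/
theorem exists_chartedSpace_levelSet (hV : Module.finrank ℝ V + 1 = Module.finrank ℝ E)
    {f : M → ℝ} (hf : ContMDiff 𝓘(ℝ, E) 𝓘(ℝ, ℝ) ∞ f) (a : ℝ)
    (ha : ∀ p, f p = a → mfderiv 𝓘(ℝ, E) 𝓘(ℝ, ℝ) f p ≠ 0) :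
    ∃ _ : ChartedSpace V {x // f x = a}, IsManifold 𝓘(ℝ, V) ∞ {x // f x = a} ∧
      ContMDiff 𝓘(ℝ, V) 𝓘(ℝ, E) ∞ (Subtype.val : {x // f x = a} → M) ∧
      ∀ p : {x // f x = a}, ∃ ρ : M → {x // f x = a},
        ContMDiffAt 𝓘(ℝ, E) 𝓘(ℝ, V) ∞ ρ p ∧ ∀ᶠ x : {x // f x = a} in 𝓝 p, ρ x = x := by
  choose c hpc hc hcs hct using fun p : {x // f x = a} ↦ exists_adapted_chart hV hf p (ha p p.2)
  let χ (p : {x // f x = a}) := sliceChart p (c p) (hc p)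
  let cs : ChartedSpace V {x // f x = a} :=
    { atlas := Set.range χ
      chartAt := χ
      mem_chart_source := hpc
      chart_mem_atlas := fun p ↦ ⟨p, rfl⟩ }
  have hχs (p : {x // f x = a}) (v : V) (hv : v ∈ (χ p).target) :
      ContMDiffAt 𝓘(ℝ, V) 𝓘(ℝ, E) ∞ (fun v ↦ ((χ p).symm v : M)) v := by
    have h1 : ContMDiffAt 𝓘(ℝ, V) 𝓘(ℝ, ℝ × V) ∞ (fun v : V ↦ (a, v)) v :=
      contMDiffAt_iff_contDiffAt.2 (by fun_prop)
    have h2 := (hct p _ hv).contMDiffAt ((c p).open_target.mem_nhds hv)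
    refine (h2.comp v h1).congr_of_eventuallyEq ?_
    filter_upwards [(χ p).open_target.mem_nhds hv] with w hw
    exact coe_sliceChart_symm p (c p) (hc p) hw
  have hsnd (p : {x // f x = a}) (x : M) (hx : x ∈ (c p).source) :
      ContMDiffAt 𝓘(ℝ, E) 𝓘(ℝ, V) ∞ (fun x ↦ (c p x).2) x :=
    (contMDiffAt_iff_contDiffAt.2 (contDiffAt_snd (𝕜 := ℝ) (E := ℝ) (F := V))).comp x
      ((hcs p x hx).contMDiffAt ((c p).open_source.mem_nhds hx))
  have hman : IsManifold 𝓘(ℝ, V) ∞ {x // f x = a} := by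
    refine isManifold_of_contDiffOn _ _ _ ?_
    rintro _ _ ⟨p, rfl⟩ ⟨q, rfl⟩
    intro v hv
    simp only [modelWithCornersSelf_coe, modelWithCornersSelf_coe_symm, Set.preimage_id,
      Set.range_id, Set.inter_univ, OpenPartialHomeomorph.trans_source,
      OpenPartialHomeomorph.symm_source] at hv
    refine ContDiffAt.contDiffWithinAt ?_
    rw [← contMDiffAt_iff_contDiffAt]
    -- A transition map factors through the ambient manifold as a smooth parametrization followed by
    -- a smooth coordinate map.
    exact ContMDiffAt.comp (g := fun x ↦ (c q x).2) (f := fun v ↦ ((χ p).symm v : M)) v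
      (hsnd q _ hv.2) (hχs p v hv.1)
  refine ⟨cs, hman, ?_, ?_⟩
  · intro p
    have h1 := contMDiffAt_of_mem_maximalAtlas (I := 𝓘(ℝ, V)) (n := ∞)
      (IsManifold.chart_mem_maximalAtlas (M := {x // f x = a}) p) (mem_chart_source V p)
    refine ((hχs p _ (mem_chart_target V p)).comp p h1).congr_of_eventuallyEq ?_
    filter_upwards [(χ p).open_source.mem_nhds (hpc p)] with x hx
    exact congrArg Subtype.val ((χ p).left_inv hx).symm
  · intro p
    -- In the adapted chart the retraction replaces the first coordinate, which is `f`, by `a`.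
    refine ⟨fun x ↦ (χ p).symm (c p x).2, ?_, ?_⟩
    · exact (contMDiffAt_symm_of_mem_maximalAtlas (I := 𝓘(ℝ, V)) (n := ∞)
        (IsManifold.chart_mem_maximalAtlas (M := {x // f x = a}) p) (mem_chart_target V p)).comp
        (p : M) (hsnd p p (hpc p))
    · filter_upwards [(χ p).open_source.mem_nhds (hpc p)] with x hx
      exact (χ p).left_inv hx

end LevelSet

/-! ### Pullbacks of tensor fields and inverses of isometries -/

section Pullback

open Topology

variable {E' : Type*} [NormedAddCommGroup E'] [NormedSpace ℝ E']
  {X' : Type*} [TopologicalSpace X'] {J' : ModelWithCorners ℝ E' X'}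
  {M' : Type*} [TopologicalSpace M'] [ChartedSpace X' M']
  {E : Type*} [NormedAddCommGroup E] [NormedSpace ℝ E]
  {X : Type*} [TopologicalSpace X] {J : ModelWithCorners ℝ E X}
  {M : Type*} [TopologicalSpace M] [ChartedSpace X M]

/-- The pullback of a field of bilinear forms. -/
def BilinField.pullback (J' : ModelWithCorners ℝ E' X') (g : BilinField J M) (f : M' → M) :
    BilinField J' M' :=
  fun x ↦
    let B : E →L[ℝ] E →L[ℝ] ℝ := g (f x)
    let D : E' →L[ℝ] E := mfderiv J' J f x
    (B.bilinearComp D D : E' →L[ℝ] E' →L[ℝ] ℝ)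

theorem BilinField.pullback_apply (g : BilinField J M) (f : M' → M) (x : M')
    (v w : TangentSpace J' x) :
    g.pullback J' f x v w = g (f x) (mfderiv J' J f x v) (mfderiv J' J f x w) := rfl

/-- The pullback of a field of covectors. -/
def CovectorField.pullback (J' : ModelWithCorners ℝ E' X') (θ : CovectorField J M) (f : M' → M) :
    CovectorField J' M' :=
  fun x ↦ (θ (f x)).comp (mfderiv J' J f x)

theorem CovectorField.pullback_apply (θ : CovectorField J M) (f : M' → M) (x : M')
    (v : TangentSpace J' x) : θ.pullback J' f x v = θ (f x) (mfderiv J' J f x v) := rfl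

/-- The derivative of a map with a local left inverse is injective. -/
theorem mfderiv_injective_of_eventually_leftInverse {f : M' → M} {r : M → M'} {x : M'}
    (hf : MDifferentiableAt J' J f x) (hr : MDifferentiableAt J J' r (f x))
    (h : ∀ᶠ y in 𝓝 x, r (f y) = y) : Function.Injective (mfderiv J' J f x) := by
  intro v w hvw
  have key (v : TangentSpace J' x) : v = mfderiv J J' r (f x) (mfderiv J' J f x v) := by
    have h1 : r ∘ f =ᶠ[𝓝 x] id := h
    have h2 := mfderiv_comp_apply x hr hf v
    rw [h1.mfderiv_eq, mfderiv_id] at h2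
    exact h2
  exact (key v).trans ((congrArg _ hvw).trans (key w).symm)

/-- The inverse of an isometry is an isometry. -/
theorem AreIsometric.symm {g : BilinField J M} {g' : BilinField J' M'} (h : AreIsometric g g') :
    AreIsometric g' g := by
  obtain ⟨T, hT⟩ := h
  refine ⟨T.symm, fun y v w ↦ ?_⟩
  obtain ⟨x, rfl⟩ := T.surjective y
  have key (v : TangentSpace J' (T x)) : mfderiv J J' T x (mfderiv J' J T.symm (T x) v) = v := by
    have h2 := mfderiv_comp_apply_of_eq (T x) (T.contMDiff.mdifferentiable (by simp) x)
      (T.symm.contMDiff.mdifferentiable (by simp) (T x)) (T.symm_apply_apply x) v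
    have h3 : T ∘ T.symm = id := funext T.apply_symm_apply
    rw [h3, mfderiv_id] at h2
    exact h2.symm
  have h1 := hT x (mfderiv J' J T.symm (T x) v) (mfderiv J' J T.symm (T x) w)
  rw [key, key, one_mul] at h1
  -- `T.symm (T x) = x` is not definitional; viewing all tangent spaces as `E` allows the base point
  -- to be rewritten.
  have h2 (z : M) (hz : z = x) (a b : E) :
      (g z : E →L[ℝ] E →L[ℝ] ℝ) a b = (g x : E →L[ℝ] E →L[ℝ] ℝ) a b := by rw [hz]
  rw [one_mul]
  exact (h2 _ (T.symm_apply_apply x) _ _).trans h1.symm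

variable [IsManifold J ∞ M] [IsManifold J' ∞ M'] [FiniteDimensional ℝ E']

theorem BilinField.contMDiff_pullback {g : BilinField J M}
    (hg : ContMDiff J (J.prod 𝓘(ℝ, E →L[ℝ] E →L[ℝ] ℝ)) ∞
      (fun x ↦ TotalSpace.mk' (E →L[ℝ] E →L[ℝ] ℝ)
        (E := fun x : M ↦ TangentSpace J x →L[ℝ] TangentSpace J x →L[ℝ] ℝ) x (g x)))
    {f : M' → M} (hf : ContMDiff J' J ∞ f) :
    ContMDiff J' (J'.prod 𝓘(ℝ, E' →L[ℝ] E' →L[ℝ] ℝ)) ∞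
      (fun x ↦ TotalSpace.mk' (E' →L[ℝ] E' →L[ℝ] ℝ)
        (E := fun x : M' ↦ TangentSpace J' x →L[ℝ] TangentSpace J' x →L[ℝ] ℝ) x
        (g.pullback J' f x)) :=
  BilinField.contMDiff_of_apply fun _ _ _ hv hw ↦
    BilinField.contMDiffAt_apply hg (hf.contMDiffAt_mfderiv_apply hv)
      (hf.contMDiffAt_mfderiv_apply hw)

theorem CovectorField.IsSmooth.pullback {θ : CovectorField J M} (hθ : θ.IsSmooth)
    {f : M' → M} (hf : ContMDiff J' J ∞ f) : (θ.pullback J' f).IsSmooth :=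
  CovectorField.isSmooth_of_apply fun _ _ hv ↦
    hθ.contMDiffAt_apply (hf.contMDiffAt_mfderiv_apply hv)

end Pullback

/-! ### The generator of a splitting -/

namespace HomothetyGroup.Splitting

variable {E : Type*} [NormedAddCommGroup E] [NormedSpace ℝ E]
  {M : Type u} [TopologicalSpace M] [ChartedSpace E M]
  {g : BilinField 𝓘(ℝ, E) M} {𝓗 : HomothetyGroup g} (S : 𝓗.Splitting)

theorem flow_add (s t : ℝ) : S.flow (s + t) = S.flow s * S.flow t := by
  rw [flow, flow, flow, ← map_mul]
  congr 1
  exact Prod.ext (Subtype.ext (Real.exp_add s t)) (one_mul 1).symm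

theorem flow_zero : S.flow 0 = 1 := by
  rw [flow, ← map_one S.iso.symm]
  congr 1
  exact Prod.ext (Subtype.ext Real.exp_zero) rfl

theorem char_flow (s : ℝ) : (𝓗.char (S.flow s) : ℝ) = Real.exp s := by
  rw [← S.fst_iso, flow, S.iso.apply_symm_apply]

/-- The flow has trivial component in the kernel and `ℝ⁺` is commutative. -/
theorem flow_mul_comm (s : ℝ) (h : 𝓗.H) : S.flow s * h = h * S.flow s := by
  apply S.iso.injective
  rw [map_mul, map_mul, flow, S.iso.apply_symm_apply]
  exact Prod.ext (mul_comm _ _) ((one_mul _).trans (mul_one _).symm)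

theorem flow_smul_comm (s : ℝ) (h : 𝓗.H) (x : M) : S.flow s • h • x = h • S.flow s • x := by
  rw [smul_smul, S.flow_mul_comm, ← smul_smul]

theorem contMDiff_flow : ContMDiff 𝓘(ℝ, ℝ) 𝓘(ℝ, 𝓗.F) ∞ S.flow := by
  let := S.normedAddCommGroup
  let := S.normedSpace
  let := S.chartedSpace
  exact S.contMDiff_iso_symm.comp (contMDiff_exp_posReal.prodMk contMDiff_const)

theorem contMDiff_flow_smul :
    ContMDiff (𝓘(ℝ, ℝ).prod 𝓘(ℝ, E)) 𝓘(ℝ, E) ∞ (fun p : ℝ × M ↦ S.flow p.1 • p.2) :=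
  (contMDiff_smul (I := 𝓘(ℝ, 𝓗.F)) (I' := 𝓘(ℝ, E)) (G := 𝓗.H) (M := M)).comp
    ((S.contMDiff_flow.comp contMDiff_fst).prodMk contMDiff_snd)

theorem _root_.HomothetyGroup.contMDiff_const_smul (𝓗 : HomothetyGroup g) (h : 𝓗.H) :
    ContMDiff 𝓘(ℝ, E) 𝓘(ℝ, E) ∞ (fun x : M ↦ h • x) :=
  (contMDiff_smul (I := 𝓘(ℝ, 𝓗.F)) (I' := 𝓘(ℝ, E)) (G := 𝓗.H) (M := M)).comp
    (contMDiff_const.prodMk contMDiff_id)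

theorem contMDiff_orbit (x : M) : ContMDiff 𝓘(ℝ, ℝ) 𝓘(ℝ, E) ∞ (fun s : ℝ ↦ S.flow s • x) :=
  S.contMDiff_flow_smul.comp (contMDiff_id.prodMk contMDiff_const)

/-- The generator is invariant under the group. -/
theorem mfderiv_smul_generator (h : 𝓗.H) (x : M) :
    mfderiv 𝓘(ℝ, E) 𝓘(ℝ, E) (fun y : M ↦ h • y) x (S.generator x) = S.generator (h • x) := by
  have h1 := mfderiv_comp_apply_of_eq (I := 𝓘(ℝ, ℝ)) (I' := 𝓘(ℝ, E)) (I'' := 𝓘(ℝ, E))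
    (f := fun s : ℝ ↦ S.flow s • x) (g := fun y : M ↦ h • y) (y := x) (0 : ℝ)
    ((𝓗.contMDiff_const_smul h).mdifferentiable (by simp) x)
    ((S.contMDiff_orbit x).mdifferentiable (by simp) 0) (by rw [S.flow_zero, one_smul]) (1 : ℝ)
  -- By centrality `h` carries the flow line of `x` to the flow line of `h • x`, hence velocity to
  -- velocity.
  have h2 : (fun y : M ↦ h • y) ∘ (fun s : ℝ ↦ S.flow s • x) = fun s ↦ S.flow s • h • x :=
    funext fun s ↦ (S.flow_smul_comm s h x).symm
  rw [h2] at h1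
  exact h1.symm

/-- The derivative of an orbit of the flow. -/
theorem mfderiv_orbit (s a : ℝ) (x : M) :
    mfderiv 𝓘(ℝ, ℝ) 𝓘(ℝ, E) (fun s : ℝ ↦ S.flow s • x) s a =
      mfderiv 𝓘(ℝ, E) 𝓘(ℝ, E) (fun y : M ↦ S.flow s • y) x (a • S.generator x) := by
  have h0 : HasMFDerivAt 𝓘(ℝ, ℝ) 𝓘(ℝ, ℝ) (fun r : ℝ ↦ r - s) s (ContinuousLinearMap.id ℝ ℝ) :=
    ((hasFDerivAt_id s).sub_const s).hasMFDerivAt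
  have h1 := mfderiv_comp_apply_of_eq (I := 𝓘(ℝ, ℝ)) (I' := 𝓘(ℝ, ℝ)) (I'' := 𝓘(ℝ, E))
    (f := fun r : ℝ ↦ r - s) (g := fun r : ℝ ↦ S.flow r • S.flow s • x) (y := 0) s
    ((S.contMDiff_orbit (S.flow s • x)).mdifferentiable (by simp) 0)
    h0.mdifferentiableAt (sub_self s) a
  -- Restarting the orbit at `Φ_s x` reduces the velocity at time `s` to the generator there.
  have h2 : (fun r : ℝ ↦ S.flow r • S.flow s • x) ∘ (fun r : ℝ ↦ r - s) =
      fun r ↦ S.flow r • x := by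
    funext r
    rw [Function.comp_apply, smul_smul, ← S.flow_add, sub_add_cancel]
  rw [h2, h0.mfderiv] at h1
  rw [map_smul, S.mfderiv_smul_generator]
  refine h1.trans ?_
  have h3 (L : ℝ →L[ℝ] E) : L a = a • L 1 := by rw [← map_smul, smul_eq_mul, mul_one]
  exact h3 _

/-- Both partial derivatives factor through the differential of `Φ_s`, so the homothety property of
`Φ_s` can be applied to their sum. -/
theorem mfderiv_flow_smul (s a : ℝ) (x : M) (v : TangentSpace 𝓘(ℝ, E) x) :
    mfderiv (𝓘(ℝ, ℝ).prod 𝓘(ℝ, E)) 𝓘(ℝ, E) (fun p : ℝ × M ↦ S.flow p.1 • p.2) (s, x) (a, v) =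
      mfderiv 𝓘(ℝ, E) 𝓘(ℝ, E) (fun y : M ↦ S.flow s • y) x (a • S.generator x + v) := by
  refine (mfderiv_prod_eq_add_apply
    (S.contMDiff_flow_smul.mdifferentiable (by simp) (s, x))).trans ?_
  rw [map_add, ← S.mfderiv_orbit]

theorem contMDiff_generator [IsManifold 𝓘(ℝ, E) ∞ M] :
    ContMDiff 𝓘(ℝ, E) 𝓘(ℝ, E).tangent ∞
      (fun x ↦ (⟨x, S.generator x⟩ : TangentBundle 𝓘(ℝ, E) M)) := by
  -- The vector `∂_s` at `(0, x)`; the tangent map of the flow sends it to the generator, which is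
  -- therefore smooth.
  let σ : M → TangentBundle (𝓘(ℝ, ℝ).prod 𝓘(ℝ, E)) (ℝ × M) := fun x ↦
    (equivTangentBundleProd 𝓘(ℝ, ℝ) ℝ 𝓘(ℝ, E) M).symm
      ((⟨0, (1 : ℝ)⟩ : TangentBundle 𝓘(ℝ, ℝ) ℝ), zeroSection E (TangentSpace 𝓘(ℝ, E)) x)
  have hσ : ContMDiff 𝓘(ℝ, E) (𝓘(ℝ, ℝ).prod 𝓘(ℝ, E)).tangent ∞ σ :=
    contMDiff_equivTangentBundleProd_symm.comp
      (contMDiff_const.prodMk (contMDiff_zeroSection ℝ (TangentSpace 𝓘(ℝ, E) : M → Type _)))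
  refine ((S.contMDiff_flow_smul.contMDiff_tangentMap (m := ∞) (by simp)).comp hσ).congr
    fun x ↦ ?_
  have h1 : tangentMap (𝓘(ℝ, ℝ).prod 𝓘(ℝ, E)) 𝓘(ℝ, E) (fun p : ℝ × M ↦ S.flow p.1 • p.2) (σ x) =
      ⟨S.flow 0 • x, S.generator (S.flow 0 • x)⟩ := by
    refine TotalSpace.ext rfl (heq_of_eq ?_)
    refine (S.mfderiv_flow_smul 0 1 x 0).trans ?_
    rw [← S.mfderiv_smul_generator, one_smul, add_zero]
  rw [Function.comp_apply, h1, S.flow_zero, one_smul]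

/-- The squared length of the generator. -/
def lengthSq (x : M) : ℝ := g x (S.generator x) (S.generator x)

theorem lengthSq_smul (h : 𝓗.H) (x : M) :
    S.lengthSq (h • x) = (𝓗.char h : ℝ) ^ 2 * S.lengthSq x := by
  rw [lengthSq, ← S.mfderiv_smul_generator]
  exact 𝓗.homothety h x _ _

theorem contMDiff_lengthSq [IsManifold 𝓘(ℝ, E) ∞ M] (hg : g.IsPseudoRiemannian) :
    ContMDiff 𝓘(ℝ, E) 𝓘(ℝ, ℝ) ∞ S.lengthSq := fun x ↦
  BilinField.contMDiffAt_apply hg.smooth (S.contMDiff_generator x) (S.contMDiff_generator x)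

/-- Along the flow line of `x` the squared length is `e^{2s}` times its value at `x`, so its
derivative in the direction of the generator is twice that value. -/
theorem mfderiv_lengthSq_ne_zero [IsManifold 𝓘(ℝ, E) ∞ M] (hg : g.IsPseudoRiemannian) {x : M}
    (hx : S.lengthSq x ≠ 0) : mfderiv 𝓘(ℝ, E) 𝓘(ℝ, ℝ) S.lengthSq x ≠ 0 := by
  intro h
  have h1 := mfderiv_comp_apply_of_eq (I := 𝓘(ℝ, ℝ)) (I' := 𝓘(ℝ, E)) (I'' := 𝓘(ℝ, ℝ))
    (f := fun s : ℝ ↦ S.flow s • x) (g := S.lengthSq) (y := x) (0 : ℝ)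
    ((S.contMDiff_lengthSq hg).mdifferentiable (by simp) x)
    ((S.contMDiff_orbit x).mdifferentiable (by simp) 0) (by rw [S.flow_zero, one_smul]) (1 : ℝ)
  have h2 : S.lengthSq ∘ (fun s : ℝ ↦ S.flow s • x) = fun s ↦ Real.exp s ^ 2 * S.lengthSq x :=
    funext fun s ↦ by rw [Function.comp_apply, S.lengthSq_smul, S.char_flow]
  have h3 : HasDerivAt (fun s ↦ Real.exp s ^ 2 * S.lengthSq x) (2 * S.lengthSq x) 0 := by
    simpa using ((Real.hasDerivAt_exp 0).pow 2).mul_const (S.lengthSq x)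
  rw [h2, h, mfderiv_eq_fderiv, h3.hasFDerivAt.fderiv] at h1
  have h4 : (1 : ℝ) • (2 * S.lengthSq x) = 0 := h1
  simp [hx] at h4

end HomothetyGroup.Splitting

section

open Topology

/-- A map into a level set with local smooth retractions is smooth if it is smooth as a map into the
ambient space. -/
theorem contMDiff_levelSet_of_coe {E : Type*} [NormedAddCommGroup E] [NormedSpace ℝ E]
    {V : Type*} [NormedAddCommGroup V] [NormedSpace ℝ V]
    {M : Type*} [TopologicalSpace M] [ChartedSpace E M] {f : M → ℝ} {a : ℝ}
    [ChartedSpace V {x // f x = a}]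
    (hρ : ∀ p : {x // f x = a}, ∃ ρ : M → {x // f x = a},
      ContMDiffAt 𝓘(ℝ, E) 𝓘(ℝ, V) ∞ ρ p ∧ ∀ᶠ x : {x // f x = a} in 𝓝 p, ρ x = x)
    {E' : Type*} [NormedAddCommGroup E'] [NormedSpace ℝ E'] {X' : Type*} [TopologicalSpace X']
    {J' : ModelWithCorners ℝ E' X'} {P : Type*} [TopologicalSpace P] [ChartedSpace X' P]
    {φ : P → {x // f x = a}} (h : ContMDiff J' 𝓘(ℝ, E) ∞ (fun y ↦ (φ y : M))) :
    ContMDiff J' 𝓘(ℝ, V) ∞ φ := by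
  intro y
  obtain ⟨ρ, hρ1, hρ2⟩ := hρ (φ y)
  have hφ : Continuous φ := Topology.IsInducing.subtypeVal.continuous_iff.2 h.continuous
  refine (hρ1.comp y (h y)).congr_of_eventuallyEq ?_
  filter_upwards [hφ.continuousAt.eventually hρ2] with z hz
  exact hz.symm

end

/-! ### The unit level of the generator and the product decomposition -/

namespace HomothetyGroup.Splitting

section

variable {E : Type*} [NormedAddCommGroup E] [NormedSpace ℝ E]
  {M : Type u} [TopologicalSpace M] [ChartedSpace E M]
  {g : BilinField 𝓘(ℝ, E) M} {𝓗 : HomothetyGroup g} (S : 𝓗.Splitting)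

/-- The embedding of the kernel of the homothety character in the group given by a splitting. -/
def kerHom : 𝓗.char.ker →* 𝓗.H :=
  S.iso.symm.toMonoidHom.comp (MonoidHom.inr PosReal 𝓗.char.ker)

theorem char_kerHom (k : 𝓗.char.ker) : 𝓗.char (S.kerHom k) = 1 := by
  rw [← S.fst_iso]
  exact congrArg Prod.fst (S.iso.apply_symm_apply (1, k))

theorem kerHom_injective : Function.Injective S.kerHom := fun _ _ h ↦
  congrArg Prod.snd (S.iso.symm.injective h)

theorem exists_kerHom_eq {h : 𝓗.H} (hh : 𝓗.char h = 1) : ∃ k, S.kerHom k = h := by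
  refine ⟨(S.iso h).2, S.iso.symm_apply_eq.2 (Prod.ext ?_ rfl)⟩
  exact ((S.fst_iso h).trans hh).symm

theorem lengthSq_kerHom_smul (k : 𝓗.char.ker) (x : M) :
    S.lengthSq (S.kerHom k • x) = S.lengthSq x := by
  rw [S.lengthSq_smul, S.char_kerHom]
  simp

theorem lengthSq_flow_smul (s : ℝ) (x : M) :
    S.lengthSq (S.flow s • x) = Real.exp s ^ 2 * S.lengthSq x := by
  rw [S.lengthSq_smul, S.char_flow]

/-- The hypersurface on which the generator has length one. -/
abbrev UnitLevel : Type u := {x : M // S.lengthSq x = 1}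

/-- The action goes through `kerHom` and not the inclusion: a splitting may twist the kernel by an
automorphism, and `kerHom` is smooth directly from the smoothness of `iso.symm`. -/
instance : MulAction 𝓗.char.ker S.UnitLevel where
  smul k x := ⟨S.kerHom k • (x : M), (S.lengthSq_kerHom_smul k x).trans x.2⟩
  one_smul x := Subtype.ext (by
    change S.kerHom 1 • (x : M) = x
    rw [map_one, one_smul])
  mul_smul k l x := Subtype.ext (by
    change S.kerHom (k * l) • (x : M) = S.kerHom k • S.kerHom l • (x : M)
    rw [map_mul, mul_smul])

/-- A group element joining two points of the unit level satisfies `λ² = 1`, so `λ = 1` by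
positivity and it comes from the kernel. -/
instance : MulAction.IsPretransitive 𝓗.char.ker S.UnitLevel := by
  refine ⟨fun x y ↦ ?_⟩
  obtain ⟨h, hh⟩ := MulAction.exists_smul_eq 𝓗.H (x : M) (y : M)
  have h1 := S.lengthSq_smul h x
  rw [hh, x.2, y.2, mul_one] at h1
  have h2 : 𝓗.char h = 1 :=
    Subtype.ext ((sq_eq_sq₀ (𝓗.char h).2.le zero_le_one).1 (by rw [← h1, one_pow]))
  obtain ⟨k, rfl⟩ := S.exists_kerHom_eq h2
  exact ⟨k, Subtype.ext hh⟩

/-- The parameter `s` for which `Φ_{-s} x` lies on the unit level. -/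
def height (x : M) : ℝ := Real.log (S.lengthSq x) / 2

variable {S}

theorem IsSpacelike.exp_height_sq (hS : S.IsSpacelike) (x : M) :
    Real.exp (S.height x) ^ 2 = S.lengthSq x := by
  rw [← Real.exp_nat_mul, height, Nat.cast_ofNat, mul_div_cancel₀ _ two_ne_zero]
  exact Real.exp_log (hS x)

/-- The projection to the unit level along the flow. -/
def IsSpacelike.proj (hS : S.IsSpacelike) (x : M) : S.UnitLevel :=
  ⟨S.flow (-S.height x) • x, by
    rw [S.lengthSq_flow_smul, Real.exp_neg, ← hS.exp_height_sq x, inv_pow,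
      inv_mul_cancel₀ (pow_ne_zero 2 (Real.exp_ne_zero _))]⟩

/-- The flow identifies `ℝ × N` with `M`, where `N` is the unit level. -/
def IsSpacelike.flowEquiv (hS : S.IsSpacelike) : ℝ × S.UnitLevel ≃ M where
  toFun p := S.flow p.1 • (p.2 : M)
  invFun x := (S.height x, hS.proj x)
  left_inv := by
    rintro ⟨s, n, hn⟩
    have h1 : S.height (S.flow s • n) = s := by
      rw [height, S.lengthSq_flow_smul, hn, mul_one, Real.log_pow, Real.log_exp, Nat.cast_ofNat,
        mul_div_cancel_left₀ _ two_ne_zero]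
    refine Prod.ext h1 (Subtype.ext ?_)
    change S.flow (-S.height (S.flow s • n)) • S.flow s • n = n
    rw [h1, smul_smul, ← S.flow_add, neg_add_cancel, S.flow_zero, one_smul]
  right_inv x := by
    change S.flow (S.height x) • S.flow (-S.height x) • x = x
    rw [smul_smul, ← S.flow_add, add_neg_cancel, S.flow_zero, one_smul]

/-- The flow commutes with the kernel and sweeps out `M` from the unit level, so the action on the
unit level determines the action on `M`. -/
theorem IsSpacelike.faithfulSMul (hS : S.IsSpacelike) :
    FaithfulSMul 𝓗.char.ker S.UnitLevel := by
  refine ⟨fun {k l} h ↦ S.kerHom_injective (FaithfulSMul.eq_of_smul_eq_smul fun x : M ↦ ?_)⟩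
  obtain ⟨⟨s, n⟩, rfl⟩ := hS.flowEquiv.surjective x
  change S.kerHom k • S.flow s • (n : M) = S.kerHom l • S.flow s • (n : M)
  rw [← S.flow_smul_comm, ← S.flow_smul_comm]
  exact congrArg (S.flow s • ·) (congrArg Subtype.val (h n))

variable [IsManifold 𝓘(ℝ, E) ∞ M]

theorem IsSpacelike.contMDiff_height (hS : S.IsSpacelike) (hg : g.IsPseudoRiemannian) :
    ContMDiff 𝓘(ℝ, E) 𝓘(ℝ, ℝ) ∞ S.height := fun x ↦
  (contMDiffAt_iff_contDiffAt.2 ((Real.contDiffAt_log.2 (hS x).ne').div_const 2)).comp x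
    (S.contMDiff_lengthSq hg x)

theorem IsSpacelike.contMDiff_coe_proj (hS : S.IsSpacelike) (hg : g.IsPseudoRiemannian) :
    ContMDiff 𝓘(ℝ, E) 𝓘(ℝ, E) ∞ (fun x ↦ (hS.proj x : M)) :=
  S.contMDiff_flow_smul.comp ((hS.contMDiff_height hg).neg.prodMk contMDiff_id)

end

variable {E : Type} [NormedAddCommGroup E] [NormedSpace ℝ E] [FiniteDimensional ℝ E]
  {M : Type u} [TopologicalSpace M] [ChartedSpace E M] [IsManifold 𝓘(ℝ, E) ∞ M]
  [T2Space M] [SecondCountableTopology M] [ConnectedSpace M]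
  {g : BilinField 𝓘(ℝ, E) M} {𝓗 : HomothetyGroup g} {S : 𝓗.Splitting}

/-- A Riemannian manifold with a transitive group of homotheties whose character splits with
spacelike generator is isometric to `e^{2x} (dx² + dx ∘ θ + g_N)` on `ℝ × N`. -/
theorem IsSpacelike.exists_qStructure (hS : S.IsSpacelike) (hg : g.IsRiemannian) :
    ∃ (Q : QStructure.{u}) (t : ℝ), t ≠ 0 ∧ (∀ y : Q.N, Q.g.dualNormSq Q.θ y ≠ 1) ∧
      AreIsometric g (Q.metric t) := by
  have hg' := hg.toIsPseudoRiemannian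
  obtain ⟨x₀⟩ := (inferInstance : Nonempty M)
  have hgen : S.generator x₀ ≠ 0 := fun h ↦ by
    have := hS x₀
    rw [h, map_zero] at this
    exact lt_irrefl _ this
  have hpos : 0 < Module.finrank ℝ E :=
    Module.finrank_pos_iff_exists_ne_zero.2 ⟨S.generator x₀, hgen⟩
  -- The nonzero generator forces positive dimension, so the natural subtraction is a genuine one.
  let V := EuclideanSpace ℝ (Fin (Module.finrank ℝ E - 1))
  have hV : Module.finrank ℝ V + 1 = Module.finrank ℝ E := by
    rw [finrank_euclideanSpace_fin]
    omega
  obtain ⟨cs, hman, hι, hρ⟩ := exists_chartedSpace_levelSet hV (S.contMDiff_lengthSq hg') 1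
    fun p hp ↦ S.mfderiv_lengthSq_ne_zero hg' (by rw [hp]; exact one_ne_zero)
  let ι : S.UnitLevel → M := Subtype.val
  have hι' (n : S.UnitLevel) : MDifferentiableAt 𝓘(ℝ, V) 𝓘(ℝ, E) ι n :=
    hι.mdifferentiable (by simp) n
  have hproj : ContMDiff 𝓘(ℝ, E) 𝓘(ℝ, V) ∞ hS.proj :=
    contMDiff_levelSet_of_coe hρ (hS.contMDiff_coe_proj hg')
  have hinj (n : S.UnitLevel) : Function.Injective (mfderiv 𝓘(ℝ, V) 𝓘(ℝ, E) ι n) := by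
    obtain ⟨ρ, hρ1, hρ2⟩ := hρ n
    exact mfderiv_injective_of_eventually_leftInverse (hι' n) (hρ1.mdifferentiableAt (by simp)) hρ2
  let := S.normedAddCommGroup
  let := S.normedSpace
  let := S.finiteDimensional
  let := S.chartedSpace
  let := S.lieGroup
  -- The unit level is a continuous image of `M`, and below the kernel is a continuous image of `H`.
  have hconn : ConnectedSpace S.UnitLevel :=
    (Prod.snd_surjective.comp hS.flowEquiv.symm.surjective).connectedSpace hproj.continuous
  have hconnG : ConnectedSpace 𝓗.char.ker :=
    (Prod.snd_surjective.comp S.iso.surjective).connectedSpace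
      (continuous_snd.comp S.contMDiff_iso.continuous)
  have hkerHom : ContMDiff 𝓘(ℝ, S.K) 𝓘(ℝ, 𝓗.F) ∞ S.kerHom :=
    S.contMDiff_iso_symm.comp (contMDiff_const.prodMk contMDiff_id)
  have hsmul : ContMDiffSMul 𝓘(ℝ, S.K) 𝓘(ℝ, V) ∞ 𝓗.char.ker S.UnitLevel :=
    ⟨contMDiff_levelSet_of_coe hρ
      ((contMDiff_smul (I := 𝓘(ℝ, 𝓗.F)) (I' := 𝓘(ℝ, E)) (G := 𝓗.H) (M := M)).comp
        ((hkerHom.comp contMDiff_fst).prodMk (hι.comp contMDiff_snd)))⟩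
  have hsc : SecondCountableTopology S.UnitLevel :=
    Topology.IsInducing.subtypeVal.secondCountableTopology
  have hfaith := hS.faithfulSMul
  have hksmul (k : 𝓗.char.ker) : ContMDiff 𝓘(ℝ, V) 𝓘(ℝ, V) ∞ (fun n : S.UnitLevel ↦ k • n) :=
    (contMDiff_smul (I := 𝓘(ℝ, S.K)) (I' := 𝓘(ℝ, V)) (G := 𝓗.char.ker) (M := S.UnitLevel)).comp
      (contMDiff_const.prodMk contMDiff_id)
  have hequiv (k : 𝓗.char.ker) (n : S.UnitLevel) (v : TangentSpace 𝓘(ℝ, V) n) :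
      mfderiv 𝓘(ℝ, V) 𝓘(ℝ, E) ι (k • n)
        (mfderiv 𝓘(ℝ, V) 𝓘(ℝ, V) (fun n : S.UnitLevel ↦ k • n) n v) =
      mfderiv 𝓘(ℝ, E) 𝓘(ℝ, E) (fun x : M ↦ S.kerHom k • x) (ι n)
        (mfderiv 𝓘(ℝ, V) 𝓘(ℝ, E) ι n v) := by
    rw [← mfderiv_comp_apply n ((𝓗.contMDiff_const_smul _).mdifferentiable (by simp) (ι n)) (hι' n),
      ← mfderiv_comp_apply n (hι' (k • n)) ((hksmul k).mdifferentiable (by simp) n)]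
    rfl
  have hflow (s a : ℝ) (n : S.UnitLevel) (v : TangentSpace 𝓘(ℝ, V) n) :
      mfderiv (𝓘(ℝ, ℝ).prod 𝓘(ℝ, V)) 𝓘(ℝ, E) (fun p : ℝ × S.UnitLevel ↦ S.flow p.1 • ι p.2)
        (s, n) (a, v) =
      mfderiv 𝓘(ℝ, E) 𝓘(ℝ, E) (fun y : M ↦ S.flow s • y) (ι n)
        (a • S.generator (ι n) + mfderiv 𝓘(ℝ, V) 𝓘(ℝ, E) ι n v) := by
    have h1 : HasMFDerivAt 𝓘(ℝ, ℝ) 𝓘(ℝ, ℝ) (id : ℝ → ℝ) s (ContinuousLinearMap.id ℝ ℝ) :=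
      hasMFDerivAt_id s
    have h2 := HasMFDerivAt.prodMap (p := (s, n)) h1 (hι' n).hasMFDerivAt
    have h3 := mfderiv_comp_apply (s, n)
      (S.contMDiff_flow_smul.mdifferentiable (by simp) (s, ι n)) h2.mdifferentiableAt (a, v)
    rw [← S.mfderiv_flow_smul]
    refine h3.trans ?_
    rw [h2.mfderiv, h1.mfderiv]
    rfl
  let θ₀ : CovectorField 𝓘(ℝ, E) M := fun x ↦ g x (S.generator x)
  have hθ₀ : θ₀.IsSmooth := CovectorField.isSmooth_of_apply fun x v hv ↦
    BilinField.contMDiffAt_apply hg'.smooth (S.contMDiff_generator x) hv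
  let Q : QStructure.{u} :=
    { E := V
      N := S.UnitLevel
      g := g.pullback 𝓘(ℝ, V) ι
      isPseudoRiemannian :=
        { smooth := BilinField.contMDiff_pullback hg'.smooth hι
          symm := fun n v w ↦ hg'.symm _ _ _
          -- A restriction of an indefinite metric could degenerate; here positivity of `g` is
          -- tested on the nonzero image of `v`.
          nondegenerate := fun n v hv ↦ by
            by_contra hne
            have h1 : mfderiv 𝓘(ℝ, V) 𝓘(ℝ, E) ι n v ≠ 0 := fun h ↦
              hne (hinj n (h.trans (map_zero _).symm))
            exact (hg.pos _ _ h1).ne' (hv v) }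
      F := S.K
      G := 𝓗.char.ker
      isometry := fun k n v w ↦ by
        simp only [BilinField.pullback_apply]
        rw [hequiv, hequiv]
        have := 𝓗.homothety (S.kerHom k) (ι n) (mfderiv 𝓘(ℝ, V) 𝓘(ℝ, E) ι n v)
          (mfderiv 𝓘(ℝ, V) 𝓘(ℝ, E) ι n w)
        rw [S.char_kerHom, Positive.val_one, one_pow] at this
        exact this
      θ := θ₀.pullback 𝓘(ℝ, V) ι
      smooth_θ := hθ₀.pullback hι
      invariant_θ := fun k n v ↦ by
        simp only [CovectorField.pullback_apply]
        rw [hequiv]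
        have := 𝓗.homothety (S.kerHom k) (ι n) (S.generator (ι n))
          (mfderiv 𝓘(ℝ, V) 𝓘(ℝ, E) ι n v)
        rw [S.char_kerHom, S.mfderiv_smul_generator, Positive.val_one, one_pow, one_mul] at this
        exact this }
  let T : Diffeomorph (𝓘(ℝ, ℝ).prod 𝓘(ℝ, V)) 𝓘(ℝ, E) (ℝ × S.UnitLevel) M ∞ :=
    { hS.flowEquiv with
      contMDiff_toFun :=
        S.contMDiff_flow_smul.comp (contMDiff_fst.prodMk (hι.comp contMDiff_snd))
      contMDiff_invFun := (hS.contMDiff_height hg').prodMk hproj }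
  -- The differential of `Φ_s` contributes `λ² = e^{2s}`, whence `t = 2`; what remains is to expand
  -- `g(aξ + v, bξ + w)` using `g(ξ, ξ) = 1` on the unit level.
  have hT : IsHomothetyWith (Q.metric 2) g T 1 := by
    rintro ⟨s, n⟩ ⟨a, v⟩ ⟨b, w⟩
    refine (congrArg₂ (fun v w : E ↦ (g (S.flow s • ι n) : E →L[ℝ] E →L[ℝ] ℝ) v w)
      (hflow s a n v) (hflow s b n w)).trans ?_
    refine (𝓗.homothety (S.flow s) (ι n) _ _).trans ?_
    have h1 : g (ι n) (S.generator (ι n)) (S.generator (ι n)) = 1 := n.2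
    refine Eq.trans ?_ (congrArg (1 * ·) (Q.metric_apply 2 (s, n) (a, v) (b, w))).symm
    have h2 := hg'.symm (ι n) (mfderiv 𝓘(ℝ, V) 𝓘(ℝ, E) ι n v) (S.generator (ι n))
    rw [S.char_flow, ← Real.exp_nat_mul, one_mul, Nat.cast_ofNat]
    simp only [map_add, map_smul, add_apply, smul_apply, smul_eq_mul, h1, h2]
    change _ = Real.exp (2 * s) * (a * b + (a * g (ι n) (S.generator (ι n))
      (mfderiv 𝓘(ℝ, V) 𝓘(ℝ, E) ι n w) + b * g (ι n) (S.generator (ι n))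
      (mfderiv 𝓘(ℝ, V) 𝓘(ℝ, E) ι n v)) + g (ι n) (mfderiv 𝓘(ℝ, V) 𝓘(ℝ, E) ι n v)
      (mfderiv 𝓘(ℝ, V) 𝓘(ℝ, E) ι n w))
    ring
  -- By the criterion of part (1) it suffices that the model metric is non-degenerate, which holds
  -- since `T` pulls the positive definite `g` back to it.
  refine ⟨Q, 2, two_ne_zero, (Q.nondegenerate_metric_iff 2).1 fun p v hv ↦ ?_,
    AreIsometric.symm ⟨T, hT⟩⟩
  by_contra hne
  have hTinj : Function.Injective (mfderiv (𝓘(ℝ, ℝ).prod 𝓘(ℝ, V)) 𝓘(ℝ, E) T p) :=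
    mfderiv_injective_of_eventually_leftInverse (T.contMDiff.mdifferentiable (by simp) p)
      (T.symm.contMDiff.mdifferentiable (by simp) (T p)) (.of_forall T.symm_apply_apply)
  have h1 : mfderiv (𝓘(ℝ, ℝ).prod 𝓘(ℝ, V)) 𝓘(ℝ, E) T p v ≠ 0 := fun h ↦
    hne (hTinj (h.trans (map_zero _).symm))
  have h2 := hT p v v
  rw [hv v, mul_zero] at h2
  exact (hg.pos _ _ h1).ne' h2

end HomothetyGroup.Splitting

end

theorem theorem1p10 :
    (∀ (Q : QStructure.{u}) (t : ℝ),
      ((Q.metric t).Nondegenerate ↔ ∀ y : Q.N, Q.g.dualNormSq Q.θ y ≠ 1) ∧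
      ((∀ y : Q.N, Q.g.dualNormSq Q.θ y ≠ 1) →
        (Q.metric t).IsPseudoRiemannian ∧
        IsHomothetyHomogeneous (Q.metric t) ∧
        (t ≠ 0 → ∃ 𝓗 : HomothetyGroup (Q.metric t), 𝓗.char ≠ 1 ∧ Nonempty 𝓗.Splitting))) ∧
    (∀ (E : Type) [NormedAddCommGroup E] [NormedSpace ℝ E] [FiniteDimensional ℝ E]
      (M : Type u) [TopologicalSpace M] [ChartedSpace E M] [IsManifold 𝓘(ℝ, E) ∞ M]
      [T2Space M] [SecondCountableTopology M] [ConnectedSpace M]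
      (g : BilinField 𝓘(ℝ, E) M) (𝓗 : HomothetyGroup g) (S : 𝓗.Splitting),
      g.IsRiemannian → 𝓗.char ≠ 1 → ¬ g.IsVSI → S.IsSpacelike →
        ∃ (Q : QStructure.{u}) (t : ℝ), t ≠ 0 ∧ (∀ y : Q.N, Q.g.dualNormSq Q.θ y ≠ 1) ∧
          AreIsometric g (Q.metric t)) := by
  refine ⟨fun Q t ↦ ⟨Q.nondegenerate_metric_iff t, fun h ↦ ⟨Q.isPseudoRiemannian_metric t h,
    Q.isHomothetyHomogeneous_metric t, fun ht ↦ ⟨Q.homothetyGroup t ht,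
      Q.homothetyGroup_char_ne_one t ht, Q.nonempty_splitting t ht⟩⟩⟩, ?_⟩
  intro E _ _ _ M _ _ _ _ _ _ g 𝓗 S hg _ _ hS
  exact hS.exists_qStructure hg
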